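/- Let $\mu$ be a $\sigma$-finite measure on a measurable space $\Omega$, let $(p_\theta)_{\theta\in\mathbb R}$ be a family of probability densities with respect to $\mu$, and let $p_\theta^n$ be the law of $n$ i.i.d. observations from $p_\theta$. For $0<s<1$ put $I^s(p\|q):=-\log\int p^s q^{1-s}\,d\mu\in[0,\infty]$. Let $g$ be a real function with $g(0)=0$ which is continuous and strictly increasing on some interval $[0,r]$, $r>0$, and suppose that $\kappa>0$ satisfies $$x^\kappa=\lim_{\epsilon\to+0}\frac{g(x\epsilon)}{g(\epsilon)}\qquad\text{for all }x>0 .$$ For a sequence $\vec T=\{T_n\}$ of (measurable) estimators $T_n:\Omega^n\to\mathbb R$ define $$\beta(\vec T,\theta,\epsilon):=\liminf_{n\to\infty}\frac{-1}{n}\log p_\theta^n\{|T_n-\theta|\ge\epsilon\}\in[0,\infty],$$ $$\alpha_2(\vec T,\theta):=\liminf_{\epsilon\to+0}\frac1{g(\epsilon)}\inf_{\theta-\epsilon\le\theta'\le\theta+\epsilon}\beta(\vec T,\theta',\epsilon),\qquad \alpha_2(\theta):=\sup_{\vec T}\alpha_2(\vec T,\theta),$$ where the supremum is over all such sequences of estimators.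 Suppose that for all $s\in(0,1)$ and $\theta\in\mathbb R$ the finite limit $$I^s_{g,\theta}:=\lim_{\epsilon\to+0}\frac{I^s(p_{\theta-\epsilon/2}\|p_{\theta+\epsilon/2})}{g(\epsilon)}$$ exists and that, for every compact $K\subset\mathbb R$, the convergence is uniform in $s\in(0,1)$ and $\theta\in K$. Then, for every $\theta\in\mathbb R$, $$\alpha_2(\theta)\le\overline\alpha_2(\theta):=\begin{cases}\displaystyle\sup_{0<s<1}\frac{I^s_{g,\theta}}{s(1-s)}\Bigl(s^{\frac1{\kappa-1}}+(1-s)^{\frac1{\kappa-1}}\Bigr)^{\kappa-1}&\text{if }\kappa<1,\\[2mm] 2I^{1/2}_{g,\theta}&\text{if }\kappa=1,\\[1mm] \displaystyle\inf_{0<s<1}\frac{I^s_{g,\theta}}{s(1-s)}\Bigl(s^{\frac1{\kappa-1}}+(1-s)^{\frac1{\kappa-1}}\Bigr)^{\kappa-1}&\text{if }\kappa>1.\end{cases}$$ -/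

import Mathlib

open Set Filter Topology MeasureTheory
open scoped NNReal ENNReal

noncomputable section

/-- `p θ` (`θ ∈ ℝ`) is a family of probability densities with respect to `μ`. -/
structure IsDensityFamily {Ω : Type*} [MeasurableSpace Ω] (μ : Measure Ω)
    (p : ℝ → Ω → ℝ≥0) : Prop where
  measurable : ∀ θ, Measurable (p θ)
  lintegral_eq_one : ∀ θ, ∫⁻ ω, (p θ ω : ℝ≥0∞) ∂μ = 1

/-- The law of `n` i.i.d. observations with density `f`. -/
def iidLaw {Ω : Type*} [MeasurableSpace Ω] (μ : Measure Ω) (f : Ω → ℝ≥0) (n : ℕ) :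
    Measure (Fin n → Ω) :=
  Measure.pi fun _ => μ.withDensity fun ω => (f ω : ℝ≥0∞)

/-- Relative Renyi entropy `I^s(f‖h) = -log ∫ f^s h^(1-s)`; it is `⊤` if the integral vanishes. -/
def relRenyi {Ω : Type*} [MeasurableSpace Ω] (μ : Measure Ω) (s : ℝ) (f h : Ω → ℝ≥0) : EReal :=
  -ENNReal.log (∫⁻ ω, ((f ω ^ s * h ω ^ (1 - s) : ℝ≥0) : ℝ≥0∞) ∂μ)

/-- First exponential rate of the sequence of estimators `T` at `θ`:
`liminf_n -(1/n) log p_θ^n {|T_n - θ| ≥ ε}`, with `-log 0 = ⊤`. -/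
def firstRate {Ω : Type*} [MeasurableSpace Ω] (μ : Measure Ω) (p : ℝ → Ω → ℝ≥0)
    (T : (n : ℕ) → (Fin n → Ω) → ℝ) (θ ε : ℝ) : EReal :=
  liminf (fun n : ℕ => (-ENNReal.log (iidLaw μ (p θ) n {x | ε ≤ |T n x - θ|})) / (n : EReal))
    atTop

/-- `α₂(T, θ) = liminf_{ε → +0} (1 / g ε) inf_{θ-ε ≤ θ' ≤ θ+ε} β(T, θ', ε)`. -/
def alphaTwoOf {Ω : Type*} [MeasurableSpace Ω] (μ : Measure Ω) (p : ℝ → Ω → ℝ≥0) (g : ℝ → ℝ)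
    (T : (n : ℕ) → (Fin n → Ω) → ℝ) (θ : ℝ) : EReal :=
  liminf (fun ε : ℝ => (⨅ θ' ∈ Icc (θ - ε) (θ + ε), firstRate μ p T θ' ε) / (g ε : EReal))
    (𝓝[>] 0)

/-- `α₂(θ)`: the supremum of `α₂(T, θ)` over all sequences of (measurable) estimators. -/
def alphaTwo {Ω : Type*} [MeasurableSpace Ω] (μ : Measure Ω) (p : ℝ → Ω → ℝ≥0) (g : ℝ → ℝ)
    (θ : ℝ) : EReal :=
  ⨆ T : (n : ℕ) → (Fin n → Ω) → ℝ, ⨆ _ : ∀ n, Measurable (T n), alphaTwoOf μ p g T θ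

/-- `I^s(p_{θ-ε/2}‖p_{θ+ε/2}) / g ε → J s θ` as `ε → +0`, uniformly in `s ∈ (0,1)` and in `θ`
on each compact subset of `ℝ`. Being close to a real limit includes being finite. -/
def RenyiLimitLocallyUniform {Ω : Type*} [MeasurableSpace Ω] (μ : Measure Ω)
    (p : ℝ → Ω → ℝ≥0) (g : ℝ → ℝ) (J : ℝ → ℝ → ℝ) : Prop :=
  ∀ K : Set ℝ, IsCompact K → ∀ δ : ℝ, 0 < δ → ∀ᶠ ε : ℝ in 𝓝[>] 0,
    ∀ s ∈ Ioo (0 : ℝ) 1, ∀ θ ∈ K,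
      relRenyi μ s (p (θ - ε / 2)) (p (θ + ε / 2)) ≠ ⊤ ∧
      |(relRenyi μ s (p (θ - ε / 2)) (p (θ + ε / 2))).toReal / g ε - J s θ| < δ

/-- The upper bound, as a function of the exponent `κ` and of `J s = I^s_{g,θ}`. -/
def alphaTwoBar (κ : ℝ) (J : ℝ → ℝ) : EReal :=
  if κ < 1 then
    ⨆ s ∈ Ioo (0 : ℝ) 1, ((J s / (s * (1 - s)) *
      (s ^ (1 / (κ - 1)) + (1 - s) ^ (1 / (κ - 1))) ^ (κ - 1) : ℝ) : EReal)
  else if κ = 1 then ((2 * J (1 / 2) : ℝ) : EReal)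
  else
    ⨅ s ∈ Ioo (0 : ℝ) 1, ((J s / (s * (1 - s)) *
      (s ^ (1 / (κ - 1)) + (1 - s) ^ (1 / (κ - 1))) ^ (κ - 1) : ℝ) : EReal)

end

/-! Fix an estimator sequence `T` and a real `α` below its rate at `θ`. For `x ∈ (0,1)` the test `{θ
≤ T n}` separates `θ - xε` from `θ + (1-x)ε` with error exponents at least `r₁ = α g(xε)` and `r₂ =
α g((1-x)ε)`. Splitting `∫ F^s G^(1-s)` over the test and its complement, applying Hölder on each
piece and letting `n → ∞` shows that the Rényi function `I` satisfies a dichotomy at each `s`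
(`chord_dichotomy_of_tests`). Infinitesimally: the tangent to `I` at `s` has value at least `r₁` at
`1` or at least `r₂` at `0`. Hence `I` meets or exceeds the line with these end values wherever its
tangent is parallel to that line. Dividing by `g ε` and letting `ε → 0`, the concave limit `J`
cannot lie strictly below the line with end values `α(1-x)^κ` at `0` and `α x^κ` at `1`
(`exists_line_lt_limit`).

Varying `x`, every line above `J` with end values `B` at `0` and `A` at `1` satisfies `α^(1/κ) ≤
A^(1/κ) + B^(1/κ)` (`rpow_inv_le_of_lines`). For `κ ≥ 1` this is applied to supporting lines, with
Hölder if `κ > 1`. For `κ < 1` it is applied to a line separating `J` from a multiple of a convex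
`ℓⁿ` norm.

The pair above has the moving midpoint `θ + (1/2 - x)ε`, so `J s` must be continuous in `θ`,
although no regularity of `θ ↦ p θ` is assumed. A Baire argument makes `J (1/2)` locally bounded on
a dense open set, where `p` is then `L¹`-continuous. Uniform convergence carries continuity of `J s`
to every point (`continuousAt_limit`). -/

/-! ### Tangent dichotomies for concave functions and their limits -/

/-- Otherwise each halving of the argument, starting at `1/2`, would raise `H` by at least `δ`,
contradicting the upper bound. This keeps points of contact away from the end points of `(0,1)`. -/
theorem exists_two_mul_lt_of_le_neg {H : ℝ → ℝ} {δ : ℝ} (hδ : 0 < δ)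
    (hH : ∀ s ∈ Ioo (0 : ℝ) 1, H s ≤ -δ) : ∃ η ∈ Ioc (0 : ℝ) (1 / 4), 2 * H η < H (2 * η) := by
  by_contra! hcon
  have key : ∀ k : ℕ, H (1 / 2) + k * δ ≤ H (1 / 2 ^ (k + 1)) := by
    intro k
    induction k with
    | zero => simp
    | succ k ih =>
      have h2 : (2 : ℝ) * (1 / 2 ^ (k + 1 + 1)) = 1 / 2 ^ (k + 1) := by
        rw [pow_succ _ (k + 1)]; field_simp
      have hpos : (0 : ℝ) < 1 / 2 ^ (k + 1 + 1) := by positivity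
      have hle : (1 : ℝ) / 2 ^ (k + 1 + 1) ≤ 1 / 4 := by
        apply one_div_le_one_div_of_le (by norm_num)
        calc (4 : ℝ) = 2 ^ 2 := by norm_num
          _ ≤ 2 ^ (k + 1 + 1) := pow_le_pow_right₀ (by norm_num) (by omega)
      have h3 := hcon _ ⟨hpos, hle⟩
      have h4 := hH _ ⟨hpos, by linarith⟩
      rw [h2] at h3
      push_cast
      linarith
  obtain ⟨k, hk⟩ := exists_nat_gt (-H (1 / 2) / δ)
  have h1 := key k
  have h2 : H (1 / 2 ^ (k + 1)) ≤ -δ := by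
    refine hH _ ⟨by positivity, ?_⟩
    rw [div_lt_one (by positivity)]
    exact one_lt_pow₀ (by norm_num) (by omega)
  rw [div_lt_iff₀ hδ] at hk
  linarith

/-- The chord dichotomy passes to the tangent line. -/
theorem tangent_dichotomy_of_chord {f : ℝ → ℝ} {s c r₁ r₂ : ℝ} (hs : s ∈ Ioo (0 : ℝ) 1)
    (hf : HasDerivAt f c s)
    (h : ∀ a b t u : ℝ, a ∈ Ioo (0 : ℝ) 1 → b ∈ Ioo (0 : ℝ) 1 → t ∈ Ioo (0 : ℝ) 1 →
      u ∈ Ioo (0 : ℝ) 1 → s = a + (1 - a) * t → s = (1 - b) * u →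
      a * r₁ + (1 - a) * f t ≤ f s ∨ b * r₂ + (1 - b) * f u ≤ f s) :
    r₁ ≤ f s + (1 - s) * c ∨ r₂ ≤ f s - s * c := by
  by_contra! hcon
  obtain ⟨hs0, hs1⟩ := hs
  have hsl := hasDerivAt_iff_tendsto_slope.1 hf
  have hnear : ∀ᶠ x in 𝓝[≠] s, f s + (1 - s) * slope f s x < r₁ ∧ f s - s * slope f s x < r₂ := by
    refine (Tendsto.eventually_lt_const hcon.1 ?_).and (Tendsto.eventually_lt_const hcon.2 ?_)
    · exact tendsto_const_nhds.add (hsl.const_mul _)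
    · exact tendsto_const_nhds.sub (hsl.const_mul _)
  have hden : ∀ᶠ a : ℝ in 𝓝[>] 0, a ∈ Ioo 0 (min s (1 - s)) :=
    Ioo_mem_nhdsGT (lt_min hs0 (by linarith))
  -- Both chords take the same weight `a = b`; the relations with `s` then determine `t` and `u`,
  -- which tend to `s` as `a → 0`.
  have ht : Tendsto (fun a : ℝ => (s - a) / (1 - a)) (𝓝[>] 0) (𝓝[≠] s) := by
    refine tendsto_nhdsWithin_iff.2 ⟨?_, ?_⟩
    · have : ContinuousAt (fun a : ℝ => (s - a) / (1 - a)) 0 := by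
        apply ContinuousAt.div <;> first | fun_prop | norm_num
      simpa using this.tendsto.mono_left nhdsWithin_le_nhds
    · filter_upwards [hden] with a ha
      have h1 := lt_min_iff.1 ha.2
      rw [mem_compl_iff, mem_singleton_iff, div_eq_iff (by linarith)]
      have := mul_pos ha.1 (sub_pos.2 hs1)
      intro h; nlinarith
  have hu : Tendsto (fun a : ℝ => s / (1 - a)) (𝓝[>] 0) (𝓝[≠] s) := by
    refine tendsto_nhdsWithin_iff.2 ⟨?_, ?_⟩
    · have : ContinuousAt (fun a : ℝ => s / (1 - a)) 0 := by
        apply ContinuousAt.div <;> first | fun_prop | norm_num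
      simpa using this.tendsto.mono_left nhdsWithin_le_nhds
    · filter_upwards [hden] with a ha
      have h1 := lt_min_iff.1 ha.2
      rw [mem_compl_iff, mem_singleton_iff, div_eq_iff (by linarith)]
      have := mul_pos ha.1 hs0
      intro h; nlinarith
  obtain ⟨a, ha, h1, h2⟩ := (hden.and ((ht.eventually hnear).and (hu.eventually hnear))).exists
  have hm := lt_min_iff.1 ha.2
  have ha0 := ha.1
  have ha1 : 0 < 1 - a := by linarith
  have ht1 : (1 - a) * ((s - a) / (1 - a)) = s - a := mul_div_cancel₀ _ ha1.ne'
  have hu1 : (1 - a) * (s / (1 - a)) = s := mul_div_cancel₀ _ ha1.ne'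
  have et := sub_smul_slope f s ((s - a) / (1 - a))
  have eu := sub_smul_slope f s (s / (1 - a))
  simp only [smul_eq_mul, vsub_eq_sub] at et eu
  set t := (s - a) / (1 - a) with htdef
  set u := s / (1 - a) with hudef
  rcases h a a t u ⟨ha0, by linarith⟩ ⟨ha0, by linarith⟩
    ⟨div_pos (by linarith) ha1, (div_lt_one ha1).2 (by linarith)⟩
    ⟨div_pos hs0 ha1, (div_lt_one ha1).2 (by linarith)⟩ (by rw [ht1]; ring) hu1.symm with h3 | h3
  · have e : (1 - a) * f t = (1 - a) * f s - a * (1 - s) * slope f s t := by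
      have : f t = f s + (t - s) * slope f s t := by linarith
      rw [this]
      linear_combination slope f s t * ht1
    have := mul_lt_mul_of_pos_left h1.1 ha0
    nlinarith
  · have e : (1 - a) * f u = (1 - a) * f s + a * s * slope f s u := by
      have : f u = f s + (u - s) * slope f s u := by linarith
      rw [this]
      linear_combination slope f s u * hu1
    have := mul_lt_mul_of_pos_left h2.2 ha0
    nlinarith

/-- At a zero of `h'` both alternatives read `0 ≤ h s`, and Darboux supplies a zero once `h' η > 0 >
h' (1 - ξ)`. At `η`, concavity bounds the tangent's value at `0` by `2 h η - h (2η) < 0`, which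
rules out the second alternative; the first forces `h' η > 0` because `h η < 0`. The other end is
symmetric. -/
theorem exists_nonneg_of_tangent_dichotomy {h : ℝ → ℝ} (hc : ConcaveOn ℝ (Ioo (0 : ℝ) 1) h)
    (hd : ∀ s ∈ Ioo (0 : ℝ) 1, DifferentiableAt ℝ h s)
    (ht : ∀ s ∈ Ioo (0 : ℝ) 1, 0 ≤ h s + (1 - s) * deriv h s ∨ 0 ≤ h s - s * deriv h s)
    {η ξ : ℝ} (hη : η ∈ Ioc (0 : ℝ) (1 / 4)) (hξ : ξ ∈ Ioc (0 : ℝ) (1 / 4)) (hη0 : h η < 0)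
    (hξ0 : h (1 - ξ) < 0) (hη2 : 2 * h η < h (2 * η)) (hξ2 : 2 * h (1 - ξ) < h (1 - 2 * ξ)) :
    ∃ s ∈ Icc η (1 - ξ), 0 ≤ h s := by
  obtain ⟨hη1, hη3⟩ := hη
  obtain ⟨hξ1, hξ3⟩ := hξ
  have mη : η ∈ Ioo (0 : ℝ) 1 := ⟨hη1, by linarith⟩
  have mη2 : 2 * η ∈ Ioo (0 : ℝ) 1 := ⟨by linarith, by linarith⟩
  have mξ : 1 - ξ ∈ Ioo (0 : ℝ) 1 := ⟨by linarith, by linarith⟩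
  have mξ2 : 1 - 2 * ξ ∈ Ioo (0 : ℝ) 1 := ⟨by linarith, by linarith⟩
  have dη : 0 < deriv h η := by
    by_contra! hle
    rcases ht η mη with h1 | h1
    · nlinarith [mul_nonneg (sub_nonneg.2 mη.2.le) (neg_nonneg.2 hle)]
    · have h2 := hc.slope_le_deriv mη mη2 (by linarith) (hd η mη)
      rw [slope_def_field, show 2 * η - η = η by ring, div_le_iff₀ hη1] at h2
      nlinarith
  have dξ : deriv h (1 - ξ) < 0 := by
    by_contra! hle
    rcases ht (1 - ξ) mξ with h1 | h1
    · have h2 := hc.deriv_le_slope mξ2 mξ (by linarith) (hd _ mξ)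
      rw [slope_def_field, show 1 - ξ - (1 - 2 * ξ) = ξ by ring, le_div_iff₀ hξ1] at h2
      nlinarith
    · nlinarith [mul_nonneg mξ.1.le hle]
  obtain ⟨s, hs, hs0⟩ := exists_hasDerivWithinAt_eq_of_lt_of_gt (f := h) (f' := deriv h)
    (a := η) (b := 1 - ξ) (m := 0) (by linarith)
    (fun x hx => (hd x ⟨by linarith [hx.1], by linarith [hx.2]⟩).hasDerivAt.hasDerivWithinAt)
    dη dξ
  refine ⟨s, ⟨hs.1.le, hs.2.le⟩, ?_⟩
  simpa [hs0] using ht s ⟨by linarith [hs.1], by linarith [hs.2]⟩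

/-- A Harnack inequality whose constant tends to `1` as `t → s`, independently of `f`. It replaces
equicontinuity when the point of evaluation moves with the function. -/
theorem concave_nonneg_le_mul {f : ℝ → ℝ} (hc : ConcaveOn ℝ (Ioo (0 : ℝ) 1) f)
    (hp : ∀ s ∈ Ioo (0 : ℝ) 1, 0 ≤ f s) {e e' s t : ℝ} (he : 0 < e) (he' : e' < 1)
    (hs : s ∈ Ioo e e') (ht : t ∈ Ioo e e') :
    f t ≤ max ((t - e) / (s - e)) ((e' - t) / (e' - s)) * f s := by
  obtain ⟨hs1, hs2⟩ := hs
  obtain ⟨ht1, ht2⟩ := ht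
  have ms : s ∈ Ioo (0 : ℝ) 1 := ⟨by linarith, by linarith⟩
  have mt : t ∈ Ioo (0 : ℝ) 1 := ⟨by linarith, by linarith⟩
  rcases le_total s t with hst | hst
  · refine le_trans ?_ (mul_le_mul_of_nonneg_right (le_max_left _ _) (hp s ms))
    have me : e ∈ Ioo (0 : ℝ) 1 := ⟨he, by linarith⟩
    have h0 : 0 < t - e := by linarith
    have := hc.2 me mt (show 0 ≤ (t - s) / (t - e) from div_nonneg (by linarith) h0.le)
      (show 0 ≤ (s - e) / (t - e) from div_nonneg (by linarith) h0.le) (by field_simp; ring)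
    have e1 : ((t - s) / (t - e)) • e + ((s - e) / (t - e)) • t = s := by
      simp only [smul_eq_mul]; field_simp; ring
    rw [e1, smul_eq_mul, smul_eq_mul] at this
    have h1 : (s - e) / (t - e) * f t ≤ f s :=
      le_trans (le_add_of_nonneg_left (mul_nonneg (div_nonneg (by linarith) h0.le) (hp e me))) this
    rw [div_mul_eq_mul_div, div_le_iff₀ h0] at h1
    rw [div_mul_eq_mul_div, le_div_iff₀ (by linarith)]
    linarith
  · refine le_trans ?_ (mul_le_mul_of_nonneg_right (le_max_right _ _) (hp s ms))
    have me : e' ∈ Ioo (0 : ℝ) 1 := ⟨by linarith, he'⟩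
    have h0 : 0 < e' - t := by linarith
    have := hc.2 me mt (show 0 ≤ (s - t) / (e' - t) from div_nonneg (by linarith) h0.le)
      (show 0 ≤ (e' - s) / (e' - t) from div_nonneg (by linarith) h0.le) (by field_simp; ring)
    have e1 : ((s - t) / (e' - t)) • e' + ((e' - s) / (e' - t)) • t = s := by
      simp only [smul_eq_mul]; field_simp; ring
    rw [e1, smul_eq_mul, smul_eq_mul] at this
    have h1 : (e' - s) / (e' - t) * f t ≤ f s :=
      le_trans (le_add_of_nonneg_left (mul_nonneg (div_nonneg (by linarith) h0.le) (hp e' me))) this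
    rw [div_mul_eq_mul_div, div_le_iff₀ h0] at h1
    rw [div_mul_eq_mul_div, le_div_iff₀ (by linarith)]
    linarith

/-- Pointwise limits of differentiable nonnegative concave functions with the tangent dichotomy
do not lie strictly below the limiting line, not even at the end points. -/
theorem exists_line_lt_of_tangent_dichotomy {ι : Type*} {l : Filter ι} [l.NeBot]
    {f : ι → ℝ → ℝ} {J : ℝ → ℝ} {r₁ r₂ : ι → ℝ} {R₁ R₂ A B : ℝ}
    (hr₁ : Tendsto r₁ l (𝓝 R₁)) (hr₂ : Tendsto r₂ l (𝓝 R₂))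
    (hconc : ∀ᶠ i in l, ConcaveOn ℝ (Ioo (0 : ℝ) 1) (f i))
    (hdiff : ∀ᶠ i in l, ∀ s ∈ Ioo (0 : ℝ) 1, DifferentiableAt ℝ (f i) s)
    (hpos : ∀ᶠ i in l, ∀ s ∈ Ioo (0 : ℝ) 1, 0 ≤ f i s)
    (htan : ∀ᶠ i in l, ∀ s ∈ Ioo (0 : ℝ) 1,
      r₁ i ≤ f i s + (1 - s) * deriv (f i) s ∨ r₂ i ≤ f i s - s * deriv (f i) s)
    (hJ : ∀ s ∈ Ioo (0 : ℝ) 1, Tendsto (fun i => f i s) l (𝓝 (J s)))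
    (hA : A < R₁) (hB : B < R₂) : ∃ s ∈ Ioo (0 : ℝ) 1, s * A + (1 - s) * B < J s := by
  by_contra! hcon
  set H : ℝ → ℝ := fun s => J s - (s * R₁ + (1 - s) * R₂) with hHdef
  set δ := min (R₁ - A) (R₂ - B) with hδdef
  have hδ : 0 < δ := lt_min (by linarith) (by linarith)
  have hHδ : ∀ s ∈ Ioo (0 : ℝ) 1, H s ≤ -δ := by
    intro s hs
    have h1 := hcon s hs
    have h2 := mul_le_mul_of_nonneg_left (min_le_left (R₁ - A) (R₂ - B)) hs.1.le
    have h3 := mul_le_mul_of_nonneg_left (min_le_right (R₁ - A) (R₂ - B)) (sub_nonneg.2 hs.2.le)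
    rw [← hδdef] at h2 h3
    simp only [hHdef]
    nlinarith
  -- `η` and `ξ` are chosen for the limit `H`; the finitely many strict inequalities then hold
  -- eventually for `h i`.
  obtain ⟨η, hη, hη2⟩ := exists_two_mul_lt_of_le_neg hδ hHδ
  obtain ⟨ξ, hξ, hξ2⟩ := exists_two_mul_lt_of_le_neg (H := fun s => H (1 - s)) hδ
    fun s hs => hHδ (1 - s) ⟨by linarith [hs.2], by linarith [hs.1]⟩
  set h : ι → ℝ → ℝ := fun i s => f i s - (s * r₁ i + (1 - s) * r₂ i) with hhdef
  have hlim : ∀ s ∈ Ioo (0 : ℝ) 1, Tendsto (fun i => h i s) l (𝓝 (H s)) := fun s hs =>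
    (hJ s hs).sub ((hr₁.const_mul s).add (hr₂.const_mul (1 - s)))
  have mη : η ∈ Ioo (0 : ℝ) 1 := ⟨hη.1, by linarith [hη.2]⟩
  have mη2 : 2 * η ∈ Ioo (0 : ℝ) 1 := ⟨by linarith [hη.1], by linarith [hη.2]⟩
  have mξ : 1 - ξ ∈ Ioo (0 : ℝ) 1 := ⟨by linarith [hξ.2], by linarith [hξ.1]⟩
  have mξ2 : 1 - 2 * ξ ∈ Ioo (0 : ℝ) 1 := ⟨by linarith [hξ.2], by linarith [hξ.1]⟩
  have hex : ∀ᶠ i in l, ∃ s ∈ Icc η (1 - ξ), 0 ≤ h i s := by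
    filter_upwards [hconc, hdiff, htan,
      (hlim η mη).eventually_lt_const (show H η < 0 by linarith [hHδ η mη]),
      (hlim _ mξ).eventually_lt_const (show H (1 - ξ) < 0 by linarith [hHδ _ mξ]),
      ((hlim η mη).const_mul 2).eventually_lt (hlim _ mη2) hη2,
      ((hlim _ mξ).const_mul 2).eventually_lt (hlim _ mξ2) hξ2] with i h1 h2 h3 h4 h5 h6 h7
    have hder : ∀ s ∈ Ioo (0 : ℝ) 1, HasDerivAt (h i) (deriv (f i) s - (r₁ i - r₂ i)) s := by
      intro s hs
      have hlin : HasDerivAt (fun s => s * r₁ i + (1 - s) * r₂ i) (r₁ i - r₂ i) s := by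
        have := ((hasDerivAt_id s).mul_const (r₁ i)).add
          (((hasDerivAt_id s).const_sub 1).mul_const (r₂ i))
        exact this.congr_deriv (by ring)
      exact (h2 s hs).hasDerivAt.sub hlin
    refine exists_nonneg_of_tangent_dichotomy ?_ (fun s hs => (hder s hs).differentiableAt) ?_
      hη hξ h4 h5 h6 h7
    · refine h1.sub ⟨convex_Ioo 0 1, fun x _ y _ a b _ _ hab => le_of_eq ?_⟩
      simp only [smul_eq_mul]
      linear_combination (-r₂ i) * hab
    · intro s hs
      rw [(hder s hs).deriv]
      simp only [hhdef]
      rcases h3 s hs with h | h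
      · left; linarith
      · right; linarith
  obtain ⟨σ, hσ⟩ := hex.choice
  -- The contact points `σ i` lie in a compact interval, so they converge along an ultrafilter finer
  -- than `l`.
  let U := Ultrafilter.of l
  have hU : (U : Filter ι) ≤ l := Ultrafilter.of_le l
  obtain ⟨s, hs, hσs⟩ := (isCompact_Icc (a := η) (b := 1 - ξ)).ultrafilter_le_nhds (U.map σ)
    (by
      rw [le_principal_iff]
      exact (hσ.filter_mono hU).mono fun i hi => hi.1)
  have hσs : Tendsto σ U (𝓝 s) := hσs
  have ms : s ∈ Ioo (0 : ℝ) 1 := ⟨by linarith [hs.1, hη.1], by linarith [hs.2, hξ.1]⟩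
  have hse : s ∈ Ioo (η / 2) (1 - ξ / 2) :=
    ⟨by linarith [hs.1, hη.1], by linarith [hs.2, hξ.1]⟩
  have hle : ∀ᶠ i in (U : Filter ι), σ i * r₁ i + (1 - σ i) * r₂ i ≤
      max ((σ i - η / 2) / (s - η / 2)) ((1 - ξ / 2 - σ i) / (1 - ξ / 2 - s)) * f i s := by
    filter_upwards [hσ.filter_mono hU, hconc.filter_mono hU, hpos.filter_mono hU] with i h1 h2 h3
    refine le_trans (sub_nonneg.1 h1.2) (concave_nonneg_le_mul h2 h3 (by linarith [hη.1])
      (by linarith [hξ.1]) hse ⟨by linarith [h1.1.1, hη.1], by linarith [h1.1.2, hξ.1]⟩)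
  have hfin := le_of_tendsto_of_tendsto
    ((hσs.mul (hr₁.mono_left hU)).add ((hσs.const_sub 1).mul (hr₂.mono_left hU)))
    ((((hσs.sub_const _).div_const _).max ((hσs.const_sub _).div_const _)).mul
      ((hJ s ms).mono_left hU)) hle
  rw [div_self (by linarith [hse.1]), div_self (by linarith [hse.2]), max_self, one_mul] at hfin
  have := hHδ s ms
  simp only [hHdef] at this
  linarith

/-! ### Supporting and separating lines -/

theorem le_on_Icc_of_le_on_Ioo {φ ψ : ℝ → ℝ} (hφ : Continuous φ) (hψ : Continuous ψ)
    (h : ∀ s ∈ Ioo (0 : ℝ) 1, φ s ≤ ψ s) : ∀ s ∈ Icc (0 : ℝ) 1, φ s ≤ ψ s := by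
  rw [← closure_Ioo zero_ne_one]
  exact (isClosed_le hφ hψ).closure_subset_iff.2 h

/-- A concave function on `(0,1)` is separated by a line from a convex set above its graph. -/
theorem exists_line_between {J : ℝ → ℝ} (hJ : ConcaveOn ℝ (Ioo (0 : ℝ) 1) J) {C : Set (ℝ × ℝ)}
    (hC : Convex ℝ C) (hne : C.Nonempty) (hJC : ∀ q ∈ C, q.1 ∈ Ioo (0 : ℝ) 1 ∧ J q.1 ≤ q.2) :
    ∃ A B : ℝ, (∀ s ∈ Ioo (0 : ℝ) 1, J s ≤ s * A + (1 - s) * B) ∧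
      ∀ q ∈ C, q.1 * A + (1 - q.1) * B ≤ q.2 := by
  have hopen : IsOpen {q : ℝ × ℝ | q.1 ∈ Ioo (0 : ℝ) 1 ∧ q.2 < J q.1} := by
    have hcont : ContinuousOn (fun q : ℝ × ℝ => J q.1 - q.2) (Prod.fst ⁻¹' Ioo (0 : ℝ) 1) :=
      ((hJ.continuousOn isOpen_Ioo).comp continuousOn_fst fun q hq => hq).sub continuousOn_snd
    convert hcont.isOpen_inter_preimage (isOpen_Ioo.preimage continuous_fst)
      (isOpen_Ioi (a := (0 : ℝ))) using 1
    ext q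
    simp
  obtain ⟨φ, u, h1, h2⟩ := geometric_hahn_banach_open hJ.convex_strict_hypograph hopen hC
    (Set.disjoint_left.2 fun q hq hqC => absurd (hJC q hqC).2 (not_le.2 hq.2))
  have hφ : ∀ s t : ℝ, φ (s, t) = s * φ (1, 0) + t * φ (0, 1) := by
    intro s t
    rw [← smul_eq_mul, ← smul_eq_mul, ← map_smul, ← map_smul, ← map_add]
    simp
  set c := φ (1, 0)
  set e := φ (0, 1)
  have he : 0 < e := by
    obtain ⟨⟨s, t⟩, hst⟩ := hne
    have h3 := h1 (s, J s - 1) ⟨(hJC _ hst).1, by simp⟩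
    have h4 := h2 _ hst
    have h5 : J s ≤ t := (hJC _ hst).2
    rw [hφ] at h3 h4
    by_contra! hle
    nlinarith [mul_nonneg (neg_nonneg.2 hle) (show 0 ≤ t - (J s - 1) by linarith)]
  refine ⟨(u - c) / e, u / e, fun s hs => ?_, fun q hq => ?_⟩
  · refine le_of_forall_lt fun t ht => ?_
    have h3 := h1 (s, t) ⟨hs, ht⟩
    rw [hφ] at h3
    rw [show s * ((u - c) / e) + (1 - s) * (u / e) = (u - s * c) / e by ring, lt_div_iff₀ he]
    linarith
  · have h3 := h2 q hq
    rw [show q = (q.1, q.2) from rfl, hφ] at h3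
    rw [show q.1 * ((u - c) / e) + (1 - q.1) * (u / e) = (u - q.1 * c) / e by ring,
      div_le_iff₀ he]
    linarith

theorem line_nonneg_of_ge {J : ℝ → ℝ} (hp : ∀ s ∈ Ioo (0 : ℝ) 1, 0 ≤ J s) {A B : ℝ}
    (h : ∀ s ∈ Ioo (0 : ℝ) 1, J s ≤ s * A + (1 - s) * B) : 0 ≤ A ∧ 0 ≤ B := by
  have := le_on_Icc_of_le_on_Ioo (φ := fun _ => 0) (ψ := fun s => s * A + (1 - s) * B)
    (by fun_prop) (by fun_prop) fun s hs => (hp s hs).trans (h s hs)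
  exact ⟨by simpa using this 1 (by simp), by simpa using this 0 (by simp)⟩

theorem exists_supporting_line {J : ℝ → ℝ} (hJ : ConcaveOn ℝ (Ioo (0 : ℝ) 1) J) {s : ℝ}
    (hs : s ∈ Ioo (0 : ℝ) 1) :
    ∃ A B : ℝ, (∀ t ∈ Ioo (0 : ℝ) 1, J t ≤ t * A + (1 - t) * B) ∧ s * A + (1 - s) * B = J s := by
  obtain ⟨A, B, h1, h2⟩ := exists_line_between hJ (convex_singleton (s, J s)) (by simp)
    (by rintro q rfl; exact ⟨hs, le_rfl⟩)
  exact ⟨A, B, h1, le_antisymm (h2 _ rfl) (h1 s hs)⟩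

/-! ### From dominating lines to the three bounds -/

/-- Absorbs `1 / (s (1 - s))` into the power, giving the form in which Hölder's inequality produces
the bound. -/
theorem mul_rpow_add_rpow_eq {κ : ℝ} (hκ : κ ≠ 1) {s : ℝ} (hs : s ∈ Ioo (0 : ℝ) 1) (j : ℝ) :
    j / (s * (1 - s)) * (s ^ (1 / (κ - 1)) + (1 - s) ^ (1 / (κ - 1))) ^ (κ - 1) =
      j * (s ^ (-(1 / (κ - 1))) + (1 - s) ^ (-(1 / (κ - 1)))) ^ (κ - 1) := by
  have h0 := hs.1
  have h1 : 0 < 1 - s := sub_pos.2 hs.2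
  have hk : κ - 1 ≠ 0 := sub_ne_zero.2 hκ
  set m := 1 / (κ - 1) with hm
  have hp := Real.rpow_pos_of_pos h0 m
  have hq := Real.rpow_pos_of_pos h1 m
  have e : s ^ (-m) + (1 - s) ^ (-m) = (s ^ m + (1 - s) ^ m) * (s * (1 - s)) ^ (-m) := by
    rw [Real.mul_rpow h0.le h1.le, Real.rpow_neg h0.le, Real.rpow_neg h1.le]
    field_simp
    ring
  rw [e, Real.mul_rpow (by positivity) (by positivity), ← Real.rpow_mul (by positivity),
    show -m * (κ - 1) = -1 by rw [hm]; field_simp, Real.rpow_neg_one]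
  ring

/-- Consequence of the estimates along all splittings of the parameter interval. -/
theorem rpow_inv_le_of_lines {J : ℝ → ℝ} {α κ : ℝ} (hα : 0 < α) (hκ : 0 < κ)
    (h : ∀ x ∈ Ioo (0 : ℝ) 1, ∀ A B : ℝ, A < α * x ^ κ → B < α * (1 - x) ^ κ →
      ∃ s ∈ Ioo (0 : ℝ) 1, s * A + (1 - s) * B < J s) {A B : ℝ} (hA : 0 ≤ A) (hB : 0 ≤ B)
    (hAB : ∀ s ∈ Ioo (0 : ℝ) 1, J s ≤ s * A + (1 - s) * B) :
    α ^ (1 / κ) ≤ A ^ (1 / κ) + B ^ (1 / κ) := by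
  by_contra! hlt
  set γ := α ^ (1 / κ) with hγ
  set a := A ^ (1 / κ) with ha
  set b := B ^ (1 / κ) with hb
  have hγ0 : 0 < γ := by positivity
  have ha0 : 0 ≤ a := by positivity
  have hb0 : 0 ≤ b := by positivity
  have eγ : γ ^ κ = α := by rw [hγ, ← Real.rpow_mul hα.le, one_div_mul_cancel hκ.ne', Real.rpow_one]
  have eA : a ^ κ = A := by rw [ha, ← Real.rpow_mul hA, one_div_mul_cancel hκ.ne', Real.rpow_one]
  have eB : b ^ κ = B := by rw [hb, ← Real.rpow_mul hB, one_div_mul_cancel hκ.ne', Real.rpow_one]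
  -- With `x = y / γ`, the inequalities `a < y` and `b < γ - y` are the `κ`-th roots of `A < α x^κ`
  -- and `B < α (1-x)^κ`.
  obtain ⟨y, hy1, hy2⟩ := exists_between (show a < γ - b by linarith)
  have hx0 : 0 < y / γ := div_pos (by linarith) hγ0
  have hx1 : y / γ < 1 := (div_lt_one hγ0).2 (by linarith)
  obtain ⟨s, hs, hlt⟩ := h (y / γ) ⟨hx0, hx1⟩ A B
    (by
      rw [← eγ, ← Real.mul_rpow hγ0.le hx0.le, mul_div_cancel₀ _ hγ0.ne', ← eA]
      exact Real.rpow_lt_rpow ha0 hy1 hκ)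
    (by
      rw [← eγ, ← Real.mul_rpow hγ0.le (by linarith), ← eB,
        show γ * (1 - y / γ) = γ - y by field_simp]
      exact Real.rpow_lt_rpow hb0 (by linarith) hκ)
  exact absurd (hAB s hs) (not_le.2 hlt)

section Bounds

variable {J : ℝ → ℝ} {α κ : ℝ}

theorem le_two_mul_of_lines (hJ : ConcaveOn ℝ (Ioo (0 : ℝ) 1) J)
    (hp : ∀ s ∈ Ioo (0 : ℝ) 1, 0 ≤ J s)
    (h : ∀ A B : ℝ, 0 ≤ A → 0 ≤ B → (∀ s ∈ Ioo (0 : ℝ) 1, J s ≤ s * A + (1 - s) * B) →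
      α ≤ A + B) : α ≤ 2 * J (1 / 2) := by
  obtain ⟨A, B, h1, h2⟩ := exists_supporting_line hJ (s := 1 / 2) (by norm_num)
  obtain ⟨hA, hB⟩ := line_nonneg_of_ge hp h1
  have := h A B hA hB h1
  linarith

theorem le_of_lines_of_one_lt (hα : 0 < α) (hκ : 1 < κ) (hJ : ConcaveOn ℝ (Ioo (0 : ℝ) 1) J)
    (hp : ∀ s ∈ Ioo (0 : ℝ) 1, 0 ≤ J s)
    (h : ∀ A B : ℝ, 0 ≤ A → 0 ≤ B → (∀ s ∈ Ioo (0 : ℝ) 1, J s ≤ s * A + (1 - s) * B) →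
      α ^ (1 / κ) ≤ A ^ (1 / κ) + B ^ (1 / κ)) {s : ℝ} (hs : s ∈ Ioo (0 : ℝ) 1) :
    α ≤ J s / (s * (1 - s)) * (s ^ (1 / (κ - 1)) + (1 - s) ^ (1 / (κ - 1))) ^ (κ - 1) := by
  obtain ⟨A, B, h1, h2⟩ := exists_supporting_line hJ hs
  obtain ⟨hA, hB⟩ := line_nonneg_of_ge hp h1
  have h3 := h A B hA hB h1
  rw [mul_rpow_add_rpow_eq hκ.ne' hs]
  have hs0 := hs.1
  have hs1 : 0 < 1 - s := sub_pos.2 hs.2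
  have hk : 0 < κ - 1 := sub_pos.2 hκ
  have hκ0 : 0 < κ := by linarith
  have hconj : κ.HolderConjugate (κ / (κ - 1)) := Real.HolderConjugate.conjExponent hκ
  -- The weights make the products `A^(1/κ)` and `B^(1/κ)`, while the `κ`-norm contains only `s A +
  -- (1-s) B = J s`.
  have hH := Real.inner_le_Lp_mul_Lq_of_nonneg (Finset.univ : Finset (Fin 2)) hconj
    (f := ![(s * A) ^ (1 / κ), ((1 - s) * B) ^ (1 / κ)])
    (g := ![s ^ (-(1 / κ)), (1 - s) ^ (-(1 / κ))])
    (by intro i _; fin_cases i <;> simp <;> positivity)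
    (by intro i _; fin_cases i <;> simp <;> positivity)
  simp only [Fin.sum_univ_two, Matrix.cons_val_zero, Matrix.cons_val_one] at hH
  have e1 : ∀ y z : ℝ, 0 < y → 0 ≤ z → (y * z) ^ (1 / κ) * y ^ (-(1 / κ)) = z ^ (1 / κ) := by
    intro y z hy hz
    rw [Real.mul_rpow hy.le hz, mul_right_comm, ← Real.rpow_add hy, add_neg_cancel,
      Real.rpow_zero, one_mul]
  have e2 : ∀ z : ℝ, 0 ≤ z → (z ^ (1 / κ)) ^ κ = z := by
    intro z hz
    rw [← Real.rpow_mul hz, one_div_mul_cancel hκ0.ne', Real.rpow_one]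
  have e3 : ∀ z : ℝ, 0 < z → (z ^ (-(1 / κ))) ^ (κ / (κ - 1)) = z ^ (-(1 / (κ - 1))) := by
    intro z hz
    rw [← Real.rpow_mul hz.le]
    congr 1
    field_simp
  rw [e1 s A hs0 hA, e1 (1 - s) B hs1 hB, e2 _ (by positivity), e2 _ (by positivity),
    e3 s hs0, e3 (1 - s) hs1, h2] at hH
  have hJ0 := hp s hs
  have h4 := Real.rpow_le_rpow (by positivity) (h3.trans hH) hκ0.le
  rw [e2 α hα.le, Real.mul_rpow (by positivity) (by positivity), e2 _ hJ0,
    ← Real.rpow_mul (by positivity), show 1 / (κ / (κ - 1)) * κ = κ - 1 by field_simp] at h4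
  exact h4

theorem convexOn_two_norm {n : ℝ} (hn : 1 ≤ n) {M : ℝ} (hM : 0 ≤ M) :
    ConvexOn ℝ (Ioo (0 : ℝ) 1) fun s => M * (s ^ n + (1 - s) ^ n) ^ (1 / n) := by
  have hn0 : 0 < n := by linarith
  refine ConvexOn.smul hM ⟨convex_Ioo 0 1, fun x hx y hy a b ha hb hab => ?_⟩
  have hx0 := hx.1
  have hx1 : 0 < 1 - x := sub_pos.2 hx.2
  have hy0 := hy.1
  have hy1 : 0 < 1 - y := sub_pos.2 hy.2
  have hH := Real.Lp_add_le_of_nonneg (Finset.univ : Finset (Fin 2)) hn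
    (f := ![a * x, a * (1 - x)]) (g := ![b * y, b * (1 - y)])
    (by intro i _; fin_cases i <;> simp <;> positivity)
    (by intro i _; fin_cases i <;> simp <;> positivity)
  simp only [Fin.sum_univ_two, Matrix.cons_val_zero, Matrix.cons_val_one] at hH
  have e : ∀ c z w : ℝ, 0 ≤ c → 0 < z → 0 < w →
      ((c * z) ^ n + (c * w) ^ n) ^ (1 / n) = c * (z ^ n + w ^ n) ^ (1 / n) := by
    intro c z w hc hz hw
    rw [Real.mul_rpow hc hz.le, Real.mul_rpow hc hw.le, ← mul_add,
      Real.mul_rpow (by positivity) (by positivity), ← Real.rpow_mul hc,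
      mul_one_div_cancel hn0.ne', Real.rpow_one]
  rw [e a x _ ha hx0 hx1, e b y _ hb hy0 hy1] at hH
  simp only [smul_eq_mul]
  rw [show 1 - (a * x + b * y) = a * (1 - x) + b * (1 - y) by
    linear_combination -hab]
  exact hH

/-- The bound by `M` says that `J` lies below `M` times the `ℓⁿ` norm of `(s, 1-s)`, `n = 1/(1-κ)`,
which is convex. A line between the two satisfies the hypothesis on lines, and duality of norms
bounds its end values through `M`. -/
theorem le_of_lines_of_lt_one (hα : 0 < α) (hκ0 : 0 < κ) (hκ : κ < 1)
    (hJ : ConcaveOn ℝ (Ioo (0 : ℝ) 1) J) (hp : ∀ s ∈ Ioo (0 : ℝ) 1, 0 ≤ J s)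
    (h : ∀ A B : ℝ, 0 ≤ A → 0 ≤ B → (∀ s ∈ Ioo (0 : ℝ) 1, J s ≤ s * A + (1 - s) * B) →
      α ^ (1 / κ) ≤ A ^ (1 / κ) + B ^ (1 / κ)) {M : ℝ}
    (hM : ∀ s ∈ Ioo (0 : ℝ) 1,
      J s / (s * (1 - s)) * (s ^ (1 / (κ - 1)) + (1 - s) ^ (1 / (κ - 1))) ^ (κ - 1) ≤ M) :
    α ≤ M := by
  have hk : 0 < 1 - κ := sub_pos.2 hκ
  set n := 1 / (1 - κ) with hn
  have hn0 : 0 < n := by positivity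
  have hn1 : 1 ≤ n := by rw [hn, le_div_iff₀ hk]; linarith
  have hnm : -(1 / (κ - 1)) = n := by rw [hn, ← neg_sub 1 κ, div_neg, neg_neg]
  have hn2 : 1 / n = 1 - κ := by rw [hn, one_div_one_div]
  have hJM : ∀ s ∈ Ioo (0 : ℝ) 1, J s ≤ M * (s ^ n + (1 - s) ^ n) ^ (1 / n) := by
    intro s hs
    have h1 := hM s hs
    have hs0 := hs.1
    have hs1 : 0 < 1 - s := sub_pos.2 hs.2
    rw [mul_rpow_add_rpow_eq hκ.ne hs, hnm, show κ - 1 = -(1 - κ) by ring,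
      Real.rpow_neg (by positivity), ← div_eq_mul_inv, div_le_iff₀ (by positivity)] at h1
    rwa [hn2]
  have hM0 : 0 ≤ M := by
    have h1 := (hp (1 / 2) (by norm_num)).trans (hJM (1 / 2) (by norm_num))
    exact nonneg_of_mul_nonneg_left h1 (by positivity)
  have hconv := convexOn_two_norm hn1 hM0
  obtain ⟨A, B, h1, h2⟩ := exists_line_between hJ hconv.convex_epigraph
    ⟨(1 / 2, M * ((1 / 2 : ℝ) ^ n + (1 - 1 / 2) ^ n) ^ (1 / n)), by norm_num, le_rfl⟩ fun q hq => ⟨hq.1, (hJM q.1 hq.1).trans hq.2⟩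
  obtain ⟨hA, hB⟩ := line_nonneg_of_ge hp h1
  have h3 := h A B hA hB h1
  have h4 := le_on_Icc_of_le_on_Ioo (φ := fun s => s * A + (1 - s) * B)
    (ψ := fun s => M * (s ^ n + (1 - s) ^ n) ^ (1 / n)) (by fun_prop)
    (continuous_const.mul ((((Real.continuous_rpow_const hn0.le)).add
      ((Real.continuous_rpow_const hn0.le).comp (continuous_const.sub continuous_id))).rpow_const
        fun _ => Or.inr (by positivity)))
    fun s hs => h2 (s, _) ⟨hs, le_rfl⟩
  set S := A ^ (1 / κ) + B ^ (1 / κ) with hS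
  have hS0 : 0 < S := lt_of_lt_of_le (by positivity) h3
  set u := A ^ ((1 - κ) / κ) with hu
  set v := B ^ ((1 - κ) / κ) with hv
  have hu0 : 0 ≤ u := by positivity
  have hv0 : 0 ≤ v := by positivity
  have hd : 0 < (1 - κ) / κ := by positivity
  have eun : u ^ n = A ^ (1 / κ) := by
    rw [hu, ← Real.rpow_mul hA]; congr 1; rw [hn]; field_simp
  have evn : v ^ n = B ^ (1 / κ) := by
    rw [hv, ← Real.rpow_mul hB]; congr 1; rw [hn]; field_simp
  have emul : ∀ z : ℝ, 0 ≤ z → z ^ ((1 - κ) / κ) * z = z ^ (1 / κ) := by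
    intro z hz
    nth_rewrite 2 [← Real.rpow_one z]
    rw [← Real.rpow_add_of_nonneg hz hd.le zero_le_one]
    congr 1; field_simp; ring
  have huv : 0 < u + v := by
    rcases hA.eq_or_lt with hA' | hA'
    · rcases hB.eq_or_lt with hB' | hB'
      · rw [hS, ← hA', ← hB', Real.zero_rpow (by positivity)] at hS0
        norm_num at hS0
      · have : 0 < v := by positivity
        linarith
    · have : 0 < u := by positivity
      linarith
  -- The equality case of Hölder: at this point the comparison becomes `S ≤ M * S^(1-κ)`. It can be
  -- an end point of `[0,1]`, hence the closed interval in `h4`.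
  have h5 := h4 (u / (u + v)) ⟨by positivity, (div_le_one huv).2 (by linarith)⟩
  rw [show 1 - u / (u + v) = v / (u + v) by field_simp; ring, Real.div_rpow hu0 huv.le,
    Real.div_rpow hv0 huv.le, ← add_div, eun, evn, ← hS,
    Real.div_rpow hS0.le (by positivity), ← Real.rpow_mul huv.le, mul_one_div_cancel hn0.ne',
    Real.rpow_one, hn2, div_mul_eq_mul_div, div_mul_eq_mul_div, ← add_div, hu, hv, emul A hA,
    emul B hB, ← hS, ← hu, ← hv, ← mul_div_assoc, div_le_div_iff_of_pos_right huv] at h5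
  have h6 : S ^ κ ≤ M := by
    have h7 : S ^ κ * S ^ (1 - κ) = S := by
      rw [← Real.rpow_add hS0]; simp
    exact le_of_mul_le_mul_right (h7.trans_le h5) (by positivity)
  calc α = (α ^ (1 / κ)) ^ κ := by
        rw [← Real.rpow_mul hα.le, one_div_mul_cancel hκ0.ne', Real.rpow_one]
    _ ≤ S ^ κ := Real.rpow_le_rpow (by positivity) h3 hκ0.le
    _ ≤ M := h6

end Bounds

/-! ### Product densities and error exponents of tests -/

theorem lintegral_pi_fin_prod {Ω : Type*} [MeasurableSpace Ω] (μ : Measure Ω) [SigmaFinite μ] :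
    ∀ (n : ℕ) (f : Fin n → Ω → ℝ≥0∞), (∀ i, Measurable (f i)) →
      ∫⁻ x, ∏ i, f i (x i) ∂(Measure.pi fun _ : Fin n => μ) = ∏ i, ∫⁻ ω, f i ω ∂μ := by
  intro n
  induction n with
  | zero => intro f _; simp
  | succ n ih =>
    intro f hf
    have hmp := (measurePreserving_piFinSuccAbove (fun _ : Fin (n + 1) => μ) 0).symm
    rw [← hmp.lintegral_comp (by fun_prop)]
    simp only [MeasurableEquiv.piFinSuccAbove_symm_apply, Fin.insertNthEquiv,
      Fin.prod_univ_succ, Fin.insertNth_zero', Equiv.coe_fn_mk, Fin.cons_zero, Fin.cons_succ]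
    have hg : Measurable fun x : Fin n → Ω => ∏ i, f i.succ (x i) := by fun_prop
    refine (lintegral_prod_mul (hf 0).aemeasurable hg.aemeasurable).trans ?_
    congr 1
    exact ih (fun i => f i.succ) fun i => hf i.succ

theorem pi_withDensity_const {Ω : Type*} [MeasurableSpace Ω] (μ : Measure Ω) [SigmaFinite μ]
    (n : ℕ) {f : Ω → ℝ≥0} (hf : Measurable f) :
    (Measure.pi fun _ : Fin n => μ.withDensity fun ω => (f ω : ℝ≥0∞)) =
      (Measure.pi fun _ : Fin n => μ).withDensity fun x => ∏ i, (f (x i) : ℝ≥0∞) := by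
  refine Measure.pi_eq fun S hS => ?_
  rw [withDensity_apply _ (MeasurableSet.univ_pi hS), ← lintegral_indicator (.univ_pi hS)]
  have : ∀ x : Fin n → Ω, (univ.pi S).indicator (fun x => ∏ i, (f (x i) : ℝ≥0∞)) x =
      ∏ i, (S i).indicator (fun ω => (f ω : ℝ≥0∞)) (x i) := by
    intro x
    by_cases hx : x ∈ univ.pi S
    · rw [indicator_of_mem hx]
      exact Finset.prod_congr rfl fun i _ => (indicator_of_mem (hx i trivial) fun ω => (f ω : ℝ≥0∞)).symm
    · rw [indicator_of_notMem hx]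
      simp only [mem_univ_pi, not_forall] at hx
      obtain ⟨i, hi⟩ := hx
      exact (Finset.prod_eq_zero (Finset.mem_univ i) (indicator_of_notMem hi _)).symm
  simp_rw [this]
  rw [lintegral_pi_fin_prod μ n (fun i => (S i).indicator fun ω => (f ω : ℝ≥0∞))
    fun i => hf.coe_nnreal_ennreal.indicator (hS i)]
  refine Finset.prod_congr rfl fun i _ => ?_
  rw [lintegral_indicator (hS i), withDensity_apply _ (hS i)]

/-- The integral `∫ f^s h^(1-s) dμ`, with values in `[0, ∞]`. -/
noncomputable def affinity {Ω : Type*} [MeasurableSpace Ω] (μ : Measure Ω) (s : ℝ)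
    (f h : Ω → ℝ≥0) : ℝ≥0∞ :=
  ∫⁻ ω, ((f ω ^ s * h ω ^ (1 - s) : ℝ≥0) : ℝ≥0∞) ∂μ

theorem lintegral_rpow_mul_rpow_eq_affinity_pow {Ω : Type*} [MeasurableSpace Ω] (μ : Measure Ω)
    [SigmaFinite μ] (n : ℕ) {f h : Ω → ℝ≥0} (hf : Measurable f) (hh : Measurable h) {s : ℝ}
    (hs : s ∈ Ioo (0 : ℝ) 1) :
    ∫⁻ x, (∏ i, (f (x i) : ℝ≥0∞)) ^ s * (∏ i, (h (x i) : ℝ≥0∞)) ^ (1 - s)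
      ∂(Measure.pi fun _ : Fin n => μ) = affinity μ s f h ^ n := by
  have h0 : 0 ≤ 1 - s := by linarith [hs.2]
  have : ∀ x : Fin n → Ω, (∏ i, (f (x i) : ℝ≥0∞)) ^ s * (∏ i, (h (x i) : ℝ≥0∞)) ^ (1 - s) =
      ∏ i, ((f (x i) ^ s * h (x i) ^ (1 - s) : ℝ≥0) : ℝ≥0∞) := by
    intro x
    rw [← ENNReal.prod_rpow_of_nonneg hs.1.le, ← ENNReal.prod_rpow_of_nonneg h0,
      ← Finset.prod_mul_distrib]
    refine Finset.prod_congr rfl fun i _ => ?_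
    rw [ENNReal.coe_mul, ENNReal.coe_rpow_of_nonneg _ hs.1.le, ENNReal.coe_rpow_of_nonneg _ h0]
  simp_rw [this]
  rw [lintegral_pi_fin_prod μ n (fun _ ω => ((f ω ^ s * h ω ^ (1 - s) : ℝ≥0) : ℝ≥0∞))
    fun i => by fun_prop]
  simp [affinity]

/-- Hölder's inequality for `F^s G^(1-s)`, where `s = a + (1-a) s'`, on a set `A`. -/
theorem setLIntegral_rpow_mul_rpow_le {X : Type*} [MeasurableSpace X] (ν : Measure X)
    {F G : X → ℝ≥0∞} (hF : Measurable F) (hG : Measurable G) (A : Set X) {a s t : ℝ}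
    (ha : a ∈ Ioo (0 : ℝ) 1) (ht : t ∈ Ioo (0 : ℝ) 1) (hs : s = a + (1 - a) * t) :
    ∫⁻ x in A, F x ^ s * G x ^ (1 - s) ∂ν ≤
      (∫⁻ x in A, F x ∂ν) ^ a * (∫⁻ x, F x ^ t * G x ^ (1 - t) ∂ν) ^ (1 - a) := by
  have ha1 : 0 < 1 - a := by linarith [ha.2]
  have ht1 : 0 < 1 - t := by linarith [ht.2]
  calc ∫⁻ x in A, F x ^ s * G x ^ (1 - s) ∂ν
      = ∫⁻ x in A, F x ^ a * (F x ^ t * G x ^ (1 - t)) ^ (1 - a) ∂ν := by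
        refine lintegral_congr fun x => ?_
        rw [ENNReal.mul_rpow_of_nonneg _ _ ha1.le, ← ENNReal.rpow_mul, ← ENNReal.rpow_mul,
          ← mul_assoc, ← ENNReal.rpow_add_of_nonneg _ _ ha.1.le (mul_pos ht.1 ha1).le]
        congr 2 <;> rw [hs] <;> ring
    _ ≤ (∫⁻ x in A, F x ∂ν) ^ a * (∫⁻ x in A, F x ^ t * G x ^ (1 - t) ∂ν) ^ (1 - a) :=
        ENNReal.lintegral_mul_norm_pow_le hF.aemeasurable
          (Measurable.aemeasurable (by fun_prop)) ha.1.le ha1.le (by ring)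
    _ ≤ _ := by
        gcongr
        exact Measure.restrict_le_self

theorem lintegral_rpow_mul_rpow_le_add {X : Type*} [MeasurableSpace X] (ν : Measure X)
    {F G : X → ℝ≥0∞} (hF : Measurable F) (hG : Measurable G) {A : Set X} (hA : MeasurableSet A)
    {a b s t u : ℝ} (ha : a ∈ Ioo (0 : ℝ) 1) (hb : b ∈ Ioo (0 : ℝ) 1) (ht : t ∈ Ioo (0 : ℝ) 1)
    (hu : u ∈ Ioo (0 : ℝ) 1) (hst : s = a + (1 - a) * t) (hsu : s = (1 - b) * u) :
    ∫⁻ x, F x ^ s * G x ^ (1 - s) ∂ν ≤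
      (∫⁻ x in A, F x ∂ν) ^ a * (∫⁻ x, F x ^ t * G x ^ (1 - t) ∂ν) ^ (1 - a) +
      (∫⁻ x in Aᶜ, G x ∂ν) ^ b * (∫⁻ x, F x ^ u * G x ^ (1 - u) ∂ν) ^ (1 - b) := by
  rw [← lintegral_add_compl _ hA]
  refine add_le_add (setLIntegral_rpow_mul_rpow_le ν hF hG A ha ht hst) ?_
  have := setLIntegral_rpow_mul_rpow_le ν hG hF Aᶜ (s := 1 - s) (t := 1 - u) hb
    ⟨by linarith [hu.2], by linarith [hu.1]⟩ (by rw [hsu]; ring)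
  simpa only [sub_sub_cancel, mul_comm] using this

/-- If tests have error probabilities at most `exp (-n r₁)` and `exp (-n r₂)`, then at every
interior point one of two chords of `I` extrapolates above these rates. -/
theorem chord_dichotomy_of_tests {Ω : Type*} [MeasurableSpace Ω] (μ : Measure Ω) [SigmaFinite μ]
    {f h : Ω → ℝ≥0} (hf : Measurable f) (hh : Measurable h) {I : ℝ → ℝ}
    (hI : ∀ s ∈ Ioo (0 : ℝ) 1, affinity μ s f h = ENNReal.ofReal (Real.exp (-I s)))
    {A : (n : ℕ) → Set (Fin n → Ω)} (hA : ∀ n, MeasurableSet (A n)) {r₁ r₂ : ℝ}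
    (h1 : ∀ᶠ n in atTop, iidLaw μ f n (A n) ≤ ENNReal.ofReal (Real.exp (-(n * r₁))))
    (h2 : ∀ᶠ n in atTop, iidLaw μ h n (A n)ᶜ ≤ ENNReal.ofReal (Real.exp (-(n * r₂))))
    {a b s t u : ℝ} (hs : s ∈ Ioo (0 : ℝ) 1) (ha : a ∈ Ioo (0 : ℝ) 1) (hb : b ∈ Ioo (0 : ℝ) 1)
    (ht : t ∈ Ioo (0 : ℝ) 1) (hu : u ∈ Ioo (0 : ℝ) 1) (hst : s = a + (1 - a) * t)
    (hsu : s = (1 - b) * u) :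
    a * r₁ + (1 - a) * I t ≤ I s ∨ b * r₂ + (1 - b) * I u ≤ I s := by
  by_contra! hcon
  obtain ⟨c1, c2⟩ := hcon
  have key : ∀ᶠ n : ℕ in atTop, (1 : ℝ) ≤ Real.exp (n * (I s - (a * r₁ + (1 - a) * I t))) +
      Real.exp (n * (I s - (b * r₂ + (1 - b) * I u))) := by
    filter_upwards [h1, h2] with n h1 h2
    have hFm : Measurable fun x : Fin n → Ω => ∏ i, (f (x i) : ℝ≥0∞) := by fun_prop
    have hGm : Measurable fun x : Fin n → Ω => ∏ i, (h (x i) : ℝ≥0∞) := by fun_prop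
    have := lintegral_rpow_mul_rpow_le_add (Measure.pi fun _ : Fin n => μ) hFm hGm (hA n)
      ha hb ht hu hst hsu
    rw [lintegral_rpow_mul_rpow_eq_affinity_pow μ n hf hh hs,
      lintegral_rpow_mul_rpow_eq_affinity_pow μ n hf hh ht,
      lintegral_rpow_mul_rpow_eq_affinity_pow μ n hf hh hu, hI s hs, hI t ht, hI u hu,
      ← withDensity_apply _ (hA n), ← withDensity_apply _ (hA n).compl,
      ← pi_withDensity_const μ n hf, ← pi_withDensity_const μ n hh] at this
    have h3 := this.trans (add_le_add
      (mul_le_mul_left (ENNReal.rpow_le_rpow h1 ha.1.le) _)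
      (mul_le_mul_left (ENNReal.rpow_le_rpow h2 hb.1.le) _))
    have e1 : ∀ x : ℝ, ENNReal.ofReal (Real.exp x) ^ n = ENNReal.ofReal (Real.exp (n * x)) := by
      intro x
      rw [← ENNReal.ofReal_pow (Real.exp_pos _).le, ← Real.exp_nat_mul]
    have e2 : ∀ x y : ℝ, ENNReal.ofReal (Real.exp x) ^ y = ENNReal.ofReal (Real.exp (x * y)) := by
      intro x y
      rw [ENNReal.ofReal_rpow_of_pos (Real.exp_pos _), ← Real.exp_mul]
    rw [e1, e1, e1, e2, e2, e2, e2, ← ENNReal.ofReal_mul (Real.exp_pos _).le,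
      ← ENNReal.ofReal_mul (Real.exp_pos _).le,
      ← ENNReal.ofReal_add (by positivity) (by positivity),
      ENNReal.ofReal_le_ofReal_iff (by positivity), ← Real.exp_add, ← Real.exp_add] at h3
    -- Normalizes the left side to `1`; if both alternatives failed, both exponentials on the right
    -- would tend to `0`.
    have h4 := mul_le_mul_of_nonneg_left h3 (Real.exp_pos (n * I s)).le
    rw [mul_add, ← Real.exp_add, ← Real.exp_add, ← Real.exp_add] at h4
    calc (1 : ℝ) = Real.exp (n * I s + n * -I s) := by rw [← Real.exp_zero]; congr 1; ring
      _ ≤ _ := h4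
      _ = _ := by congr 2 <;> ring
  have lim : ∀ c : ℝ, c < 0 → Tendsto (fun n : ℕ => Real.exp (n * c)) atTop (𝓝 0) := fun c hc =>
    Real.tendsto_exp_atBot.comp (tendsto_natCast_atTop_atTop.atTop_mul_const_of_neg hc)
  have := le_of_tendsto_of_tendsto tendsto_const_nhds
    ((lim _ (sub_neg.2 c1)).add (lim _ (sub_neg.2 c2))) key
  norm_num at this

/-! ### Concavity and differentiability of the Rényi function in `s` -/

section Renyi

variable {Ω : Type*} [MeasurableSpace Ω] {μ : Measure Ω} {f h : Ω → ℝ≥0}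

theorem affinity_eq_lintegral_rpow {s : ℝ} (hs : s ∈ Ioo (0 : ℝ) 1) (f h : Ω → ℝ≥0) :
    affinity μ s f h = ∫⁻ ω, (f ω : ℝ≥0∞) ^ s * (h ω : ℝ≥0∞) ^ (1 - s) ∂μ := by
  refine lintegral_congr fun ω => ?_
  rw [ENNReal.coe_mul, ENNReal.coe_rpow_of_nonneg _ hs.1.le,
    ENNReal.coe_rpow_of_nonneg _ (by linarith [hs.2])]

theorem affinity_le_one (hf : Measurable f) (hh : Measurable h)
    (hf1 : ∫⁻ ω, (f ω : ℝ≥0∞) ∂μ = 1) (hh1 : ∫⁻ ω, (h ω : ℝ≥0∞) ∂μ = 1) {s : ℝ}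
    (hs : s ∈ Ioo (0 : ℝ) 1) : affinity μ s f h ≤ 1 := by
  rw [affinity_eq_lintegral_rpow hs]
  refine (ENNReal.lintegral_mul_norm_pow_le hf.coe_nnreal_ennreal.aemeasurable
    hh.coe_nnreal_ennreal.aemeasurable hs.1.le (by linarith [hs.2]) (by ring)).trans ?_
  simp [hf1, hh1]

theorem affinity_eq_ofReal_exp {s : ℝ} (hle : affinity μ s f h ≤ 1)
    (hne : relRenyi μ s f h ≠ ⊤) :
    affinity μ s f h = ENNReal.ofReal (Real.exp (-(relRenyi μ s f h).toReal)) ∧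
      0 ≤ (relRenyi μ s f h).toReal := by
  have h0 : 0 ≤ relRenyi μ s f h := by
    change 0 ≤ -ENNReal.log (affinity μ s f h)
    rw [EReal.neg_nonneg, ← ENNReal.log_one]
    exact ENNReal.log_monotone hle
  have hbot : relRenyi μ s f h ≠ ⊥ := (lt_of_lt_of_le EReal.bot_lt_zero h0).ne'
  refine ⟨?_, EReal.toReal_nonneg h0⟩
  rw [← EReal.exp_coe, EReal.coe_neg, EReal.coe_toReal hne hbot]
  change _ = EReal.exp (- -ENNReal.log (affinity μ s f h))
  rw [neg_neg, ENNReal.exp_log]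

variable {I : ℝ → ℝ}

theorem concaveOn_of_affinity_eq (hf : Measurable f) (hh : Measurable h)
    (hI : ∀ s ∈ Ioo (0 : ℝ) 1, affinity μ s f h = ENNReal.ofReal (Real.exp (-I s))) :
    ConcaveOn ℝ (Ioo (0 : ℝ) 1) I := by
  refine ⟨convex_Ioo 0 1, fun s hs t ht a b ha hb hab => ?_⟩
  have hm := (convex_Ioo (0 : ℝ) 1) hs ht ha hb hab
  simp only [smul_eq_mul] at hm ⊢
  have hs0 := hs.1
  have ht0 := ht.1
  have hs1 : 0 < 1 - s := sub_pos.2 hs.2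
  have ht1 : 0 < 1 - t := sub_pos.2 ht.2
  have key : affinity μ (a * s + b * t) f h ≤ affinity μ s f h ^ a * affinity μ t f h ^ b := by
    rw [affinity_eq_lintegral_rpow hs, affinity_eq_lintegral_rpow ht,
      affinity_eq_lintegral_rpow hm]
    refine le_trans (le_of_eq (lintegral_congr fun ω => ?_))
      (ENNReal.lintegral_mul_norm_pow_le (Measurable.aemeasurable (by fun_prop))
        (Measurable.aemeasurable (by fun_prop)) ha hb hab)
    rw [ENNReal.mul_rpow_of_nonneg _ _ ha, ENNReal.mul_rpow_of_nonneg _ _ hb,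
      ← ENNReal.rpow_mul, ← ENNReal.rpow_mul, ← ENNReal.rpow_mul, ← ENNReal.rpow_mul,
      mul_mul_mul_comm, ← ENNReal.rpow_add_of_nonneg _ _ (by positivity) (by positivity),
      ← ENNReal.rpow_add_of_nonneg _ _ (by positivity) (by positivity)]
    congr 2
    · ring
    · linear_combination -hab
  rw [hI s hs, hI t ht, hI _ hm, ENNReal.ofReal_rpow_of_pos (Real.exp_pos _),
    ENNReal.ofReal_rpow_of_pos (Real.exp_pos _), ← Real.exp_mul, ← Real.exp_mul,
    ← ENNReal.ofReal_mul (Real.exp_pos _).le, ← Real.exp_add,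
    ENNReal.ofReal_le_ofReal_iff (Real.exp_pos _).le, Real.exp_le_exp] at key
  linarith

/-- The affinity is the moment generating function of `log (f / h)` under `h μ` restricted to the
common support; it is finite, hence differentiable, on the open interval. -/
theorem differentiableAt_of_affinity_eq (hf : Measurable f) (hh : Measurable h)
    (hI : ∀ s ∈ Ioo (0 : ℝ) 1, affinity μ s f h = ENNReal.ofReal (Real.exp (-I s))) :
    ∀ s ∈ Ioo (0 : ℝ) 1, DifferentiableAt ℝ I s := by
  set S : Set Ω := {ω | f ω ≠ 0} ∩ {ω | h ω ≠ 0} with hS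
  have hSm : MeasurableSet S :=
    (hf (measurableSet_singleton 0).compl).inter (hh (measurableSet_singleton 0).compl)
  set X : Ω → ℝ := fun ω => Real.log ((f ω : ℝ) / h ω) with hX
  have hXm : Measurable X := by fun_prop
  set ν := (μ.withDensity fun ω => (h ω : ℝ≥0∞)).restrict S with hν
  have hlin : ∀ s ∈ Ioo (0 : ℝ) 1,
      ∫⁻ ω, ENNReal.ofReal (Real.exp (s * X ω)) ∂ν = ENNReal.ofReal (Real.exp (-I s)) := by
    intro s hs
    have hs1 : 0 < 1 - s := sub_pos.2 hs.2
    rw [← hI s hs, hν, restrict_withDensity hSm,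
      lintegral_withDensity_eq_lintegral_mul _ hh.coe_nnreal_ennreal (by fun_prop),
      ← lintegral_indicator hSm]
    refine lintegral_congr fun ω => ?_
    by_cases hω : ω ∈ S
    · rw [indicator_of_mem hω, Pi.mul_apply]
      have hf0 : 0 < (f ω : ℝ) := NNReal.coe_pos.2 (pos_iff_ne_zero.2 hω.1)
      have hh0 : 0 < (h ω : ℝ) := NNReal.coe_pos.2 (pos_iff_ne_zero.2 hω.2)
      rw [← ENNReal.ofReal_coe_nnreal, ← ENNReal.ofReal_coe_nnreal,
        ← ENNReal.ofReal_mul hh0.le]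
      congr 1
      rw [NNReal.coe_mul, NNReal.coe_rpow, NNReal.coe_rpow, mul_comm s, hX,
        ← Real.rpow_def_of_pos (by positivity), Real.div_rpow hf0.le hh0.le,
        Real.rpow_sub hh0, Real.rpow_one]
      field_simp
    · rw [indicator_of_notMem hω]
      have : f ω = 0 ∨ h ω = 0 := by
        by_contra! hc
        exact hω hc
      rcases this with h0 | h0
      · simp [h0, NNReal.zero_rpow hs.1.ne']
      · simp [h0, NNReal.zero_rpow hs1.ne']
  have hmeas : ∀ s : ℝ, AEStronglyMeasurable (fun ω => Real.exp (s * X ω)) ν := fun s =>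
    Measurable.aestronglyMeasurable (by fun_prop)
  have hint : Ioo (0 : ℝ) 1 ⊆ ProbabilityTheory.integrableExpSet X ν := by
    intro s hs
    refine ⟨hmeas s, ?_⟩
    rw [hasFiniteIntegral_iff_ofReal (ae_of_all _ fun ω => (Real.exp_pos _).le), hlin s hs]
    exact ENNReal.ofReal_lt_top
  have hmgf : ∀ s ∈ Ioo (0 : ℝ) 1, ProbabilityTheory.mgf X ν s = Real.exp (-I s) := by
    intro s hs
    rw [ProbabilityTheory.mgf, integral_eq_lintegral_of_nonneg_ae
      (ae_of_all _ fun ω => (Real.exp_pos _).le) (hmeas s), hlin s hs,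
      ENNReal.toReal_ofReal (Real.exp_pos _).le]
  intro s hs
  have hd := ProbabilityTheory.differentiableAt_mgf
    (interior_maximal hint isOpen_Ioo hs)
  have hlog : DifferentiableAt ℝ (fun t => -Real.log (ProbabilityTheory.mgf X ν t)) s :=
    (hd.log (by rw [hmgf s hs]; exact (Real.exp_pos _).ne')).neg
  refine hlog.congr_of_eventuallyEq ?_
  filter_upwards [isOpen_Ioo.mem_nhds hs] with t ht
  rw [hmgf t ht, Real.log_exp, neg_neg]

end Renyi

/-! ### From exponential rates to error bounds -/

theorem le_ofReal_exp_of_lt_neg_log_div {m : ℝ≥0∞} {n : ℕ} (hn : 0 < n) {r : ℝ}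
    (h : (r : EReal) < -ENNReal.log m / (n : EReal)) :
    m ≤ ENNReal.ofReal (Real.exp (-(n * r))) := by
  rw [EReal.lt_div_iff (by exact_mod_cast hn) (EReal.natCast_ne_top n), EReal.lt_neg_comm] at h
  rw [← EReal.exp_coe, ← ENNReal.exp_log m]
  refine EReal.exp_monotone (h.le.trans (le_of_eq ?_))
  rw [EReal.coe_neg, EReal.coe_mul, mul_comm]
  rfl

/-- Exponential error bounds for estimators give exponential bounds for the test `{θ ≤ T}`. -/
theorem eventually_iidLaw_le_of_lt_firstRate {Ω : Type*} [MeasurableSpace Ω] {μ : Measure Ω}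
    {p : ℝ → Ω → ℝ≥0} {T : (n : ℕ) → (Fin n → Ω) → ℝ} {θ d r : ℝ}
    (h : (r : EReal) < firstRate μ p T θ d) {A : (n : ℕ) → Set (Fin n → Ω)}
    (hA : ∀ n, A n ⊆ {x | d ≤ |T n x - θ|}) :
    ∀ᶠ n in atTop, iidLaw μ (p θ) n (A n) ≤ ENNReal.ofReal (Real.exp (-(n * r))) := by
  filter_upwards [eventually_lt_of_lt_liminf h, eventually_gt_atTop 0] with n hn h0
  exact (measure_mono (hA n)).trans (le_ofReal_exp_of_lt_neg_log_div h0 hn)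

/-! ### `L¹` distance and affinity -/

section LOneDistance

variable {Ω : Type*} [MeasurableSpace Ω]

/-- The `L¹` distance of two densities. -/
noncomputable def lOneDist (μ : Measure Ω) (f h : Ω → ℝ≥0) : ℝ≥0∞ := ∫⁻ ω, edist (f ω) (h ω) ∂μ

variable {μ : Measure Ω} {f h f' h' : Ω → ℝ≥0}

theorem lOneDist_comm (f h : Ω → ℝ≥0) : lOneDist μ f h = lOneDist μ h f := by
  simp_rw [lOneDist, edist_comm]

theorem lOneDist_triangle (hf : Measurable f) (hh : Measurable h) (f' : Ω → ℝ≥0) :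
    lOneDist μ f f' ≤ lOneDist μ f h + lOneDist μ h f' := by
  rw [lOneDist, lOneDist, lOneDist, ← lintegral_add_left (hf.edist hh)]
  exact lintegral_mono fun ω => edist_triangle _ _ _

theorem coe_le_add_edist (x y : ℝ≥0) : (x : ℝ≥0∞) ≤ y + edist x y := by
  rw [edist_nndist, ← ENNReal.coe_add, ENNReal.coe_le_coe, ← NNReal.coe_le_coe, NNReal.coe_add,
    coe_nndist, NNReal.dist_eq]
  linarith [le_abs_self ((x : ℝ) - y)]

/-- Subadditivity of `x ↦ x^s` and `x ↦ x^(1-s)` replaces one density at a time; Hölder bounds each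
error term. -/
theorem affinity_le_add (hf : Measurable f) (hh : Measurable h) (hf' : Measurable f')
    (hh' : Measurable h') (hf1 : ∫⁻ ω, (f' ω : ℝ≥0∞) ∂μ = 1) (hh1 : ∫⁻ ω, (h ω : ℝ≥0∞) ∂μ = 1)
    {s : ℝ} (hs : s ∈ Ioo (0 : ℝ) 1) :
    affinity μ s f h ≤ affinity μ s f' h' + (lOneDist μ f f' ^ s + lOneDist μ h h' ^ (1 - s)) := by
  have hs0 := hs.1
  have hs1 : 0 < 1 - s := sub_pos.2 hs.2
  have e1 : ∫⁻ ω, edist (f ω) (f' ω) ^ s * (h ω : ℝ≥0∞) ^ (1 - s) ∂μ ≤ lOneDist μ f f' ^ s := by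
    refine (ENNReal.lintegral_mul_norm_pow_le (hf.edist hf').aemeasurable
      hh.coe_nnreal_ennreal.aemeasurable hs0.le hs1.le (by ring)).trans ?_
    simp [hh1, lOneDist]
  have e2 : ∫⁻ ω, (f' ω : ℝ≥0∞) ^ s * edist (h ω) (h' ω) ^ (1 - s) ∂μ ≤
      lOneDist μ h h' ^ (1 - s) := by
    refine (ENNReal.lintegral_mul_norm_pow_le hf'.coe_nnreal_ennreal.aemeasurable
      (hh.edist hh').aemeasurable hs0.le hs1.le (by ring)).trans ?_
    simp [hf1, lOneDist]
  have hm1 : Measurable fun ω => edist (f ω) (f' ω) := hf.edist hf'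
  have hm2 : Measurable fun ω => edist (h ω) (h' ω) := hh.edist hh'
  refine le_trans ?_ (add_le_add_right (add_le_add e1 e2) _)
  rw [affinity_eq_lintegral_rpow hs, affinity_eq_lintegral_rpow hs,
    ← lintegral_add_left (by fun_prop), ← lintegral_add_left (by fun_prop)]
  refine lintegral_mono fun ω => ?_
  have p1 : (f ω : ℝ≥0∞) ^ s ≤ (f' ω : ℝ≥0∞) ^ s + edist (f ω) (f' ω) ^ s :=
    (ENNReal.rpow_le_rpow (coe_le_add_edist _ _) hs0.le).trans
      (ENNReal.rpow_add_le_add_rpow _ _ hs0.le hs.2.le)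
  have p2 : (h ω : ℝ≥0∞) ^ (1 - s) ≤ (h' ω : ℝ≥0∞) ^ (1 - s) + edist (h ω) (h' ω) ^ (1 - s) :=
    (ENNReal.rpow_le_rpow (coe_le_add_edist _ _) hs1.le).trans
      (ENNReal.rpow_add_le_add_rpow _ _ hs1.le (by linarith))
  calc (f ω : ℝ≥0∞) ^ s * (h ω : ℝ≥0∞) ^ (1 - s)
      ≤ ((f' ω : ℝ≥0∞) ^ s + edist (f ω) (f' ω) ^ s) * (h ω : ℝ≥0∞) ^ (1 - s) := by gcongr
    _ = (f' ω : ℝ≥0∞) ^ s * (h ω : ℝ≥0∞) ^ (1 - s) +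
        edist (f ω) (f' ω) ^ s * (h ω : ℝ≥0∞) ^ (1 - s) := add_mul _ _ _
    _ ≤ (f' ω : ℝ≥0∞) ^ s * ((h' ω : ℝ≥0∞) ^ (1 - s) + edist (h ω) (h' ω) ^ (1 - s)) +
        edist (f ω) (f' ω) ^ s * (h ω : ℝ≥0∞) ^ (1 - s) := by gcongr
    _ = _ := by rw [mul_add]; ring

theorem lintegral_min_max (hf : Measurable f) (hh : Measurable h)
    (hf1 : ∫⁻ ω, (f ω : ℝ≥0∞) ∂μ = 1) (hh1 : ∫⁻ ω, (h ω : ℝ≥0∞) ∂μ = 1) :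
    (∫⁻ ω, ((min (f ω) (h ω) : ℝ≥0) : ℝ≥0∞) ∂μ) + ∫⁻ ω, ((max (f ω) (h ω) : ℝ≥0) : ℝ≥0∞) ∂μ = 2 ∧
    (∫⁻ ω, ((min (f ω) (h ω) : ℝ≥0) : ℝ≥0∞) ∂μ) + lOneDist μ f h =
      ∫⁻ ω, ((max (f ω) (h ω) : ℝ≥0) : ℝ≥0∞) ∂μ := by
  have hm : Measurable fun ω => ((min (f ω) (h ω) : ℝ≥0) : ℝ≥0∞) := by fun_prop
  constructor
  · rw [← lintegral_add_left hm, show (2 : ℝ≥0∞) = 1 + 1 by norm_num]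
    nth_rewrite 1 [← hf1]
    rw [← hh1, ← lintegral_add_left hf.coe_nnreal_ennreal]
    refine lintegral_congr fun ω => ?_
    rw [← ENNReal.coe_add, ← ENNReal.coe_add, min_add_max]
  · rw [lOneDist, ← lintegral_add_left hm]
    refine lintegral_congr fun ω => ?_
    rw [edist_nndist, ← ENNReal.coe_add, ENNReal.coe_inj, ← NNReal.coe_inj, NNReal.coe_add,
      coe_nndist, NNReal.dist_eq, NNReal.coe_min, NNReal.coe_max, ← max_sub_min_eq_abs,
      max_comm (h ω : ℝ), min_comm (h ω : ℝ)]
    ring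

/-- With `D` the distance, min and max integrate to `1 - D/2` and `1 + D/2`. Cauchy–Schwarz gives
`exp (-2c) ≤ 1 - D²/4`, so `D²/4 ≤ 2c`. -/
theorem lOneDist_le_of_affinity_half (hf : Measurable f) (hh : Measurable h)
    (hf1 : ∫⁻ ω, (f ω : ℝ≥0∞) ∂μ = 1) (hh1 : ∫⁻ ω, (h ω : ℝ≥0∞) ∂μ = 1) {c : ℝ}
    (hc : affinity μ (1 / 2) f h = ENNReal.ofReal (Real.exp (-c))) :
    lOneDist μ f h ≤ ENNReal.ofReal (2 * √(2 * c)) := by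
  obtain ⟨e1, e2⟩ := lintegral_min_max hf hh hf1 hh1
  set m := ∫⁻ ω, ((min (f ω) (h ω) : ℝ≥0) : ℝ≥0∞) ∂μ with hm
  set M := ∫⁻ ω, ((max (f ω) (h ω) : ℝ≥0) : ℝ≥0∞) ∂μ with hM
  have hmt : m ≠ ⊤ := ne_top_of_le_ne_top (by norm_num) (le_self_add.trans e1.le)
  have hMt : M ≠ ⊤ := ne_top_of_le_ne_top (by norm_num) (le_add_self.trans e1.le)
  have hDt : lOneDist μ f h ≠ ⊤ := ne_top_of_le_ne_top hMt (le_add_self.trans e2.le)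
  have e3 : affinity μ (1 / 2) f h ≤ m ^ (1 / 2 : ℝ) * M ^ (1 / 2 : ℝ) := by
    refine le_trans (le_of_eq ?_) (ENNReal.lintegral_mul_norm_pow_le
      (Measurable.aemeasurable (by fun_prop)) (Measurable.aemeasurable (by fun_prop))
      (by norm_num) (by norm_num) (by norm_num))
    rw [affinity_eq_lintegral_rpow (by norm_num)]
    refine lintegral_congr fun ω => ?_
    rw [show (1 : ℝ) - 1 / 2 = 1 / 2 by norm_num]
    rcases le_total (f ω) (h ω) with hle | hle
    · rw [min_eq_left hle, max_eq_right hle]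
    · rw [min_eq_right hle, max_eq_left hle, mul_comm]
  rw [hc, ← ENNReal.ofReal_toReal hmt, ← ENNReal.ofReal_toReal hMt,
    ENNReal.ofReal_rpow_of_nonneg ENNReal.toReal_nonneg (by norm_num),
    ENNReal.ofReal_rpow_of_nonneg ENNReal.toReal_nonneg (by norm_num),
    ← ENNReal.ofReal_mul (by positivity), ENNReal.ofReal_le_ofReal_iff (by positivity),
    ← Real.mul_rpow ENNReal.toReal_nonneg ENNReal.toReal_nonneg, ← Real.sqrt_eq_rpow] at e3
  have e4 := congrArg ENNReal.toReal e1
  have e5 := congrArg ENNReal.toReal e2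
  rw [ENNReal.toReal_add hmt hMt, ENNReal.toReal_ofNat] at e4
  rw [ENNReal.toReal_add hmt hDt] at e5
  refine ENNReal.le_ofReal_iff_toReal_le hDt (by positivity) |>.2 ?_
  have e6 := (Real.le_sqrt' (Real.exp_pos _)).1 e3
  rw [← Real.exp_nat_mul] at e6
  have e7 := Real.add_one_le_exp (((2 : ℕ) : ℝ) * -c)
  push_cast at e6 e7
  set D := (lOneDist μ f h).toReal
  have hD : (D / 2) ^ 2 ≤ 2 * c := by
    have hMe : M.toReal = 1 + D / 2 := by linarith
    have hme : m.toReal = 1 - D / 2 := by linarith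
    rw [hMe, hme] at e6
    nlinarith
  have := Real.le_sqrt_of_sq_le hD
  linarith

/-- The affinity is at least the integral of the minimum, here at least `1/2 > exp (-1)`. -/
theorem le_one_of_lOneDist_le_one (hf : Measurable f) (hh : Measurable h)
    (hf1 : ∫⁻ ω, (f ω : ℝ≥0∞) ∂μ = 1) (hh1 : ∫⁻ ω, (h ω : ℝ≥0∞) ∂μ = 1) {c : ℝ}
    (hc : affinity μ (1 / 2) f h = ENNReal.ofReal (Real.exp (-c))) (hD : lOneDist μ f h ≤ 1) :
    c ≤ 1 := by
  obtain ⟨e1, e2⟩ := lintegral_min_max hf hh hf1 hh1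
  set m := ∫⁻ ω, ((min (f ω) (h ω) : ℝ≥0) : ℝ≥0∞) ∂μ with hm
  have hmt : m ≠ ⊤ := ne_top_of_le_ne_top (by norm_num) (le_self_add.trans e1.le)
  have hDt : lOneDist μ f h ≠ ⊤ := ne_top_of_le_ne_top (by norm_num) hD
  rw [← e2] at e1
  have e4 := congrArg ENNReal.toReal e1
  rw [ENNReal.toReal_add hmt (ENNReal.add_ne_top.2 ⟨hmt, hDt⟩), ENNReal.toReal_add hmt hDt,
    ENNReal.toReal_ofNat] at e4
  have hD' : (lOneDist μ f h).toReal ≤ 1 := by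
    simpa using ENNReal.toReal_mono ENNReal.one_ne_top hD
  have e3 : m ≤ affinity μ (1 / 2) f h := by
    refine lintegral_mono fun ω => ENNReal.coe_le_coe.2 ?_
    rw [show (1 : ℝ) - 1 / 2 = 1 / 2 by norm_num, ← NNReal.mul_rpow]
    calc min (f ω) (h ω) = (min (f ω) (h ω) * min (f ω) (h ω)) ^ (1 / 2 : ℝ) := by
          rw [← pow_two, ← NNReal.rpow_natCast, ← NNReal.rpow_mul]; norm_num
      _ ≤ _ := by
          gcongr
          · exact min_le_left _ _
          · exact min_le_right _ _
  rw [hc] at e3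
  have e5 := ENNReal.toReal_mono ENNReal.ofReal_ne_top e3
  rw [ENNReal.toReal_ofReal (Real.exp_pos _).le] at e5
  by_contra! h1
  have e6 : Real.exp (-c) < Real.exp (-1) := Real.exp_lt_exp.2 (by linarith)
  have e7 := Real.exp_neg_one_lt_d9
  linarith

end LOneDistance

/-! ### Local boundedness from symmetric differences -/

section SymmetricDifferences

variable {D : ℝ → ℝ → ℝ≥0∞} {j : ℝ → ℝ}

/-- A Baire category argument: if `j v` controls, and is controlled by, the `D`-size of symmetric
differences at `v`, then `j` is locally bounded above on a dense set. -/
theorem dense_locally_bounded (htri : ∀ a b c, D a c ≤ D a b + D b c)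
    (H1 : ∀ K : Set ℝ, IsCompact K → ∀ N : ℝ, ∀ η : ℝ≥0∞, 0 < η → ∀ᶠ t : ℝ in 𝓝[>] 0,
      ∀ u ∈ K, j u ≤ N → D (u - t) (u + t) ≤ η)
    (H2 : ∀ K : Set ℝ, IsCompact K → ∀ᶠ τ : ℝ in 𝓝[>] 0, ∃ C : ℝ, ∀ v ∈ K,
      ∀ h ∈ Icc τ (2 * τ), D (v - h) (v + h) ≤ 1 → j v ≤ C) :
    Dense {v | ∃ C : ℝ, ∀ᶠ w in 𝓝 v, j w ≤ C} := by
  have hdense : Dense (⋃ n : ℕ, interior (closure {u | j u ≤ n})) := by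
    refine dense_iUnion_interior_of_closed (fun _ => isClosed_closure) (eq_univ_of_forall ?_)
    intro x
    obtain ⟨n, hn⟩ := exists_nat_ge (j x)
    exact mem_iUnion.2 ⟨n, subset_closure hn⟩
  refine hdense.mono (iUnion_subset fun n v hv => ?_)
  obtain ⟨ρ, hρ, hball⟩ := Metric.isOpen_iff.1 isOpen_interior v hv
  have hK : IsCompact (Icc (v - 1) (v + 1)) := isCompact_Icc
  obtain ⟨t₀, ht₀, h1⟩ :=
    mem_nhdsGT_iff_exists_Ioo_subset.1 (H1 _ hK n 2⁻¹ (by simp))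
  obtain ⟨τ, hτ, C, h2⟩ := ((show ∀ᶠ τ : ℝ in 𝓝[>] 0, τ ∈ Ioo 0 (min t₀ (min (ρ / 2) (1 / 2)))
    from Ioo_mem_nhdsGT (lt_min ht₀ (lt_min (by linarith) (by norm_num)))).and (H2 _ hK)).exists
  obtain ⟨hτ0, hτ1⟩ := hτ
  obtain ⟨hτt, hτ2⟩ := lt_min_iff.1 hτ1
  obtain ⟨hτρ, hτh⟩ := lt_min_iff.1 hτ2
  have hpick : ∀ x a b : ℝ, |x - v| < ρ → a < x → x < b → ∃ u ∈ Ioo a b, j u ≤ n := by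
    intro x a b hx hax hxb
    have : x ∈ closure {u | j u ≤ n} :=
      interior_subset (hball (by rwa [Metric.mem_ball, Real.dist_eq]))
    obtain ⟨u, hu1, hu2⟩ := mem_closure_iff.1 this _ isOpen_Ioo ⟨hax, hxb⟩
    exact ⟨u, hu1, hu2⟩
  refine ⟨C, ?_⟩
  filter_upwards [Metric.ball_mem_nhds v (show 0 < min (ρ / 2) (1 / 2) by
    exact lt_min (by linarith) (by norm_num))] with w hw
  rw [Metric.mem_ball, Real.dist_eq, lt_min_iff] at hw
  obtain ⟨hw1, hw2⟩ := hw
  have aw1 := abs_lt.1 hw1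
  have aw2 := abs_lt.1 hw2
  -- Reflecting in `u` and then in `u'` is translation by `2 (u' - u)`. This compares the pair `w ∓
  -- (u' - u)` through two symmetric differences centred at points where `j ≤ n`. The windows put
  -- `u' - u` in `[τ, 2τ]`, where `H2` has one constant `C`.
  obtain ⟨u, hu, hju⟩ := hpick (w - 3 / 4 * τ) (w - τ) (w - τ / 2)
    (abs_lt.2 ⟨by linarith, by linarith⟩) (by linarith) (by linarith)
  obtain ⟨u', hu', hju'⟩ := hpick (w + 3 / 4 * τ) (w + τ / 2) (w + τ)
    (abs_lt.2 ⟨by linarith, by linarith⟩) (by linarith) (by linarith)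
  have d1 := h1 (show u' - w ∈ Ioo 0 t₀ from ⟨by linarith [hu'.1], by linarith [hu'.2]⟩) u
    ⟨by linarith [hu.1], by linarith [hu.2]⟩ hju
  have d2 := h1 (show w - u ∈ Ioo 0 t₀ from ⟨by linarith [hu.2], by linarith [hu.1]⟩) u'
    ⟨by linarith [hu'.1], by linarith [hu'.2]⟩ hju'
  refine h2 w ⟨by linarith, by linarith⟩ (u' - u)
    ⟨by linarith [hu.2, hu'.1], by linarith [hu.1, hu'.2]⟩ ?_
  calc D (w - (u' - u)) (w + (u' - u))
      ≤ D (w - (u' - u)) (u + (u' - w)) + D (u + (u' - w)) (w + (u' - u)) := htri _ _ _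
    _ = D (u - (u' - w)) (u + (u' - w)) + D (u' - (w - u)) (u' + (w - u)) := by
        congr 2 <;> ring
    _ ≤ 2⁻¹ + 2⁻¹ := add_le_add d1 d2
    _ = 1 := ENNReal.inv_two_add_inv_two

/-- The points `v` and `w` are symmetric about their midpoint, where `j ≤ C` once `w` is near `v`.
-/
theorem tendsto_zero_of_locally_bounded (hcomm : ∀ a b, D a b = D b a) (hself : ∀ a, D a a = 0)
    (H1 : ∀ K : Set ℝ, IsCompact K → ∀ N : ℝ, ∀ η : ℝ≥0∞, 0 < η → ∀ᶠ t : ℝ in 𝓝[>] 0,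
      ∀ u ∈ K, j u ≤ N → D (u - t) (u + t) ≤ η)
    {v C : ℝ} (hv : ∀ᶠ w in 𝓝 v, j w ≤ C) : Tendsto (fun w => D v w) (𝓝 v) (𝓝 0) := by
  rw [ENNReal.tendsto_nhds_zero]
  intro η hη
  obtain ⟨t₀, ht₀, h1⟩ := mem_nhdsGT_iff_exists_Ioo_subset.1
    (H1 (Icc (v - 1) (v + 1)) isCompact_Icc C η hη)
  have hmid : Tendsto (fun w : ℝ => (v + w) / 2) (𝓝 v) (𝓝 v) := by
    have : Continuous fun w : ℝ => (v + w) / 2 := by fun_prop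
    simpa using this.tendsto v
  have ht₀' : (0 : ℝ) < t₀ := ht₀
  filter_upwards [hmid.eventually hv, Metric.ball_mem_nhds v (lt_min ht₀' one_pos)] with w hw hwb
  rw [Metric.mem_ball, Real.dist_eq, lt_min_iff] at hwb
  have a1 := abs_lt.1 hwb.1
  have a2 := abs_lt.1 hwb.2
  have hK : (v + w) / 2 ∈ Icc (v - 1) (v + 1) := ⟨by linarith, by linarith⟩
  rcases lt_trichotomy v w with h | rfl | h
  · have := h1 (show (w - v) / 2 ∈ Ioo 0 t₀ from ⟨by linarith, by linarith⟩) _ hK hw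
    convert this using 2 <;> ring
  · simp [hself]
  · have := h1 (show (v - w) / 2 ∈ Ioo 0 t₀ from ⟨by linarith, by linarith⟩) _ hK hw
    rw [hcomm]
    convert this using 2 <;> ring

end SymmetricDifferences

/-! ### Continuity of the limit in the parameter -/

section Family

variable {Ω : Type*} [MeasurableSpace Ω] {μ : Measure Ω} {p : ℝ → Ω → ℝ≥0} {g : ℝ → ℝ}
  {J : ℝ → ℝ → ℝ}

theorem eventually_renyi (hp : IsDensityFamily μ p) (hJ : RenyiLimitLocallyUniform μ p g J)
    {K : Set ℝ} (hK : IsCompact K) {δ : ℝ} (hδ : 0 < δ) :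
    ∀ᶠ ε : ℝ in 𝓝[>] 0, ∀ s ∈ Ioo (0 : ℝ) 1, ∀ θ ∈ K,
      affinity μ s (p (θ - ε / 2)) (p (θ + ε / 2)) = ENNReal.ofReal
        (Real.exp (-(relRenyi μ s (p (θ - ε / 2)) (p (θ + ε / 2))).toReal)) ∧
      0 ≤ (relRenyi μ s (p (θ - ε / 2)) (p (θ + ε / 2))).toReal ∧
      |(relRenyi μ s (p (θ - ε / 2)) (p (θ + ε / 2))).toReal / g ε - J s θ| < δ := by
  filter_upwards [hJ K hK δ hδ] with ε h s hs θ hθ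
  obtain ⟨h1, h2⟩ := h s hs θ hθ
  obtain ⟨h3, h4⟩ := affinity_eq_ofReal_exp (affinity_le_one (hp.measurable _) (hp.measurable _)
    (hp.lintegral_eq_one _) (hp.lintegral_eq_one _) hs) h1
  exact ⟨h3, h4, h2⟩

theorem eventually_gauge_pos {r : ℝ} (hr : 0 < r) (hg0 : g 0 = 0)
    (hg : StrictMonoOn g (Icc 0 r)) : ∀ᶠ ε : ℝ in 𝓝[>] 0, 0 < g ε := by
  filter_upwards [Ioo_mem_nhdsGT hr] with ε hε
  rw [← hg0]
  exact hg ⟨le_rfl, hr.le⟩ ⟨hε.1.le, hε.2.le⟩ hε.1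

theorem tendsto_const_mul_nhdsGT {x : ℝ} (hx : 0 < x) :
    Tendsto (fun t : ℝ => x * t) (𝓝[>] 0) (𝓝[>] 0) := by
  refine tendsto_nhdsWithin_iff.2 ⟨?_, ?_⟩
  · have : Continuous fun t : ℝ => x * t := by fun_prop
    simpa using (this.tendsto 0).mono_left nhdsWithin_le_nhds
  · filter_upwards [self_mem_nhdsWithin] with t ht
    exact mem_Ioi.2 (mul_pos hx (mem_Ioi.1 ht))

theorem eventually_lOneDist_le (hp : IsDensityFamily μ p)
    (hJ : RenyiLimitLocallyUniform μ p g J) (hg0 : g 0 = 0) {r : ℝ} (hr : 0 < r)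
    (hg : StrictMonoOn g (Icc 0 r)) (hgc : ContinuousOn g (Icc 0 r)) (K : Set ℝ)
    (hK : IsCompact K) (N : ℝ) (η : ℝ≥0∞) (hη : 0 < η) :
    ∀ᶠ t : ℝ in 𝓝[>] 0, ∀ u ∈ K, J (1 / 2) u ≤ N →
      lOneDist μ (p (u - t)) (p (u + t)) ≤ η := by
  have hg' : Tendsto g (𝓝[>] 0) (𝓝 0) := by
    have := (hgc 0 ⟨le_rfl, hr.le⟩).tendsto
    rw [hg0] at this
    refine this.mono_left (nhdsWithin_le_iff.2 ?_)
    filter_upwards [Ioo_mem_nhdsGT hr] with x hx using ⟨hx.1.le, hx.2.le⟩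
  have hlim : Tendsto (fun ε => ENNReal.ofReal (2 * √(2 * ((N + 1) * g ε)))) (𝓝[>] 0) (𝓝 0) := by
    have h1 : Continuous fun y : ℝ => ENNReal.ofReal (2 * √(2 * ((N + 1) * y))) :=
      ENNReal.continuous_ofReal.comp (by fun_prop)
    simpa [Function.comp_def] using (h1.tendsto 0).comp hg'
  have hev := (eventually_renyi hp hJ hK one_pos).and
    ((eventually_gauge_pos hr hg0 hg).and (hlim.eventually (eventually_le_nhds hη)))
  filter_upwards [(tendsto_const_mul_nhdsGT two_pos).eventually hev] with t ht u hu hN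
  obtain ⟨h1, h2, h3⟩ := ht
  obtain ⟨e1, e2, e3⟩ := h1 (1 / 2) (by norm_num) u hu
  rw [mul_div_cancel_left₀ t two_ne_zero] at e1 e2 e3
  refine le_trans (lOneDist_le_of_affinity_half (hp.measurable _) (hp.measurable _)
    (hp.lintegral_eq_one _) (hp.lintegral_eq_one _) e1) (le_trans ?_ h3)
  gcongr
  rw [← div_le_iff₀ h2]
  linarith [(abs_lt.1 e3).2]

/-- Distance at most `1` bounds the Rényi entropy by `1`, monotonicity of `g` bounds its quotient by
`1 / g (2τ)`, and uniform convergence costs at most `1` more. -/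
theorem eventually_limit_le_of_lOneDist (hp : IsDensityFamily μ p)
    (hJ : RenyiLimitLocallyUniform μ p g J) (hg0 : g 0 = 0) {r : ℝ} (hr : 0 < r)
    (hg : StrictMonoOn g (Icc 0 r)) (K : Set ℝ) (hK : IsCompact K) :
    ∀ᶠ τ : ℝ in 𝓝[>] 0, ∃ C : ℝ, ∀ v ∈ K, ∀ h ∈ Icc τ (2 * τ),
      lOneDist μ (p (v - h)) (p (v + h)) ≤ 1 → J (1 / 2) v ≤ C := by
  obtain ⟨e, he, h1⟩ := mem_nhdsGT_iff_exists_Ioo_subset.1 (eventually_renyi hp hJ hK one_pos)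
  have he' : (0 : ℝ) < e := he
  filter_upwards [Ioo_mem_nhdsGT (show 0 < min e r / 4 by have := lt_min he' hr; linarith)]
    with τ hτ
  obtain ⟨hτ0, hτ1⟩ := hτ
  have hτe : 4 * τ < e := by linarith [min_le_left e r]
  have hτr : 4 * τ < r := by linarith [min_le_right e r]
  have hgτ : 0 < g (2 * τ) := by
    rw [← hg0]
    exact hg ⟨le_rfl, hr.le⟩ ⟨by linarith, by linarith⟩ (by linarith)
  refine ⟨1 / g (2 * τ) + 1, fun v hv h hh hD => ?_⟩
  obtain ⟨e1, e2, e3⟩ := h1 (show 2 * h ∈ Ioo 0 e from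
    ⟨by linarith [hh.1], by linarith [hh.2]⟩) (1 / 2) (by norm_num) v hv
  rw [mul_div_cancel_left₀ h two_ne_zero] at e1 e2 e3
  have h2 := le_one_of_lOneDist_le_one (hp.measurable _) (hp.measurable _)
    (hp.lintegral_eq_one _) (hp.lintegral_eq_one _) e1 hD
  have hgh : g (2 * τ) ≤ g (2 * h) := hg.monotoneOn ⟨by linarith, by linarith⟩
    ⟨by linarith [hh.1], by linarith [hh.2]⟩ (by linarith [hh.1])
  have h3 : (relRenyi μ (1 / 2) (p (v - h)) (p (v + h))).toReal / g (2 * h) ≤ 1 / g (2 * τ) :=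
    div_le_div₀ zero_le_one h2 hgτ hgh
  linarith [(abs_lt.1 e3).1]

theorem tendsto_affinity_of_lOneDist (hp : IsDensityFamily μ p) {s θ e : ℝ} (hs : s ∈ Ioo (0 : ℝ) 1)
    (h1 : Tendsto (fun w => lOneDist μ (p (θ - e)) (p w)) (𝓝 (θ - e)) (𝓝 0))
    (h2 : Tendsto (fun w => lOneDist μ (p (θ + e)) (p w)) (𝓝 (θ + e)) (𝓝 0)) :
    Tendsto (fun w => affinity μ s (p (w - e)) (p (w + e))) (𝓝 θ)
      (𝓝 (affinity μ s (p (θ - e)) (p (θ + e)))) := by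
  have hs0 := hs.1
  have hs1 : 0 < 1 - s := sub_pos.2 hs.2
  have c1 : Tendsto (fun w => w - e) (𝓝 θ) (𝓝 (θ - e)) :=
    (continuous_id.sub continuous_const).tendsto θ
  have c2 : Tendsto (fun w => w + e) (𝓝 θ) (𝓝 (θ + e)) :=
    (continuous_id.add continuous_const).tendsto θ
  have hsm : Tendsto (fun w => lOneDist μ (p (θ - e)) (p (w - e)) ^ s +
      lOneDist μ (p (θ + e)) (p (w + e)) ^ (1 - s)) (𝓝 θ) (𝓝 0) := by
    have := ((h1.comp c1).ennrpow_const s).add ((h2.comp c2).ennrpow_const (1 - s))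
    rwa [ENNReal.zero_rpow_of_pos hs0, ENNReal.zero_rpow_of_pos hs1, add_zero] at this
  have hfin : affinity μ s (p (θ - e)) (p (θ + e)) ≠ ⊤ := ne_top_of_le_ne_top ENNReal.one_ne_top
    (affinity_le_one (hp.measurable _) (hp.measurable _) (hp.lintegral_eq_one _)
      (hp.lintegral_eq_one _) hs)
  rw [ENNReal.tendsto_nhds hfin]
  intro η hη
  filter_upwards [hsm.eventually (eventually_le_nhds hη)] with w hw
  constructor
  · rw [tsub_le_iff_right]
    exact (affinity_le_add (hp.measurable _) (hp.measurable _) (hp.measurable _)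
      (hp.measurable _) (hp.lintegral_eq_one _) (hp.lintegral_eq_one _) hs).trans
      (add_le_add_right hw _)
  · refine (affinity_le_add (hp.measurable _) (hp.measurable _) (hp.measurable _)
      (hp.measurable _) (hp.lintegral_eq_one _) (hp.lintegral_eq_one _) hs).trans
      (add_le_add_right ?_ _)
    rwa [lOneDist_comm (p (w - e)), lOneDist_comm (p (w + e))]

/-- The limits `J s` are continuous functions of the parameter. -/
theorem continuousAt_limit (hp : IsDensityFamily μ p)
    (hJ : RenyiLimitLocallyUniform μ p g J) (hg0 : g 0 = 0) {r : ℝ} (hr : 0 < r)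
    (hg : StrictMonoOn g (Icc 0 r)) (hgc : ContinuousOn g (Icc 0 r)) {s : ℝ}
    (hs : s ∈ Ioo (0 : ℝ) 1) (θ : ℝ) : ContinuousAt (J s) θ := by
  set G : Set ℝ := {v | ∃ C : ℝ, ∀ᶠ w in 𝓝 v, J (1 / 2) w ≤ C} with hG
  have hGo : IsOpen G := by
    rw [isOpen_iff_mem_nhds]
    rintro v ⟨C, hC⟩
    filter_upwards [eventually_eventually_nhds.2 hC] with w hw using ⟨C, hw⟩
  have hGd : Dense G := dense_locally_bounded (D := fun a b => lOneDist μ (p a) (p b))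
    (fun a b c => lOneDist_triangle (hp.measurable a) (hp.measurable b) (p c))
    (eventually_lOneDist_le hp hJ hg0 hr hg hgc) (eventually_limit_le_of_lOneDist hp hJ hg0 hr hg)
  have hGc : ∀ v ∈ G, Tendsto (fun w => lOneDist μ (p v) (p w)) (𝓝 v) (𝓝 0) := by
    rintro v ⟨C, hC⟩
    exact tendsto_zero_of_locally_bounded (D := fun a b => lOneDist μ (p a) (p b))
      (fun a b => lOneDist_comm _ _) (fun a => by simp [lOneDist])
      (eventually_lOneDist_le hp hJ hg0 hr hg hgc) hC
  rw [Metric.continuousAt_iff']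
  intro δ hδ
  obtain ⟨e, he, h1⟩ := mem_nhdsGT_iff_exists_Ioo_subset.1
    ((eventually_renyi hp hJ (K := Icc (θ - 1) (θ + 1)) isCompact_Icc
      (show 0 < δ / 3 by linarith)).and (eventually_gauge_pos hr hg0 hg))
  have he' : (0 : ℝ) < e := he
  -- Intersecting `G` with its reflection in `θ` yields a small `x` with both `θ - x` and `θ + x` in
  -- `G`, even if `θ` is not.
  have hrefl : Dense ((fun v => 2 * θ - v) ⁻¹' G) :=
    hGd.preimage (Homeomorph.subLeft (2 * θ)).isOpenMap
  obtain ⟨v, hv, hvG, hvR⟩ := (hGd.inter_of_isOpen_left hrefl hGo).inter_open_nonempty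
    (Ioo θ (θ + e / 2)) isOpen_Ioo ⟨θ + e / 4, by linarith, by linarith⟩
  set x := v - θ with hx
  have hε : 2 * x ∈ Ioo 0 e := ⟨by linarith [hv.1], by linarith [hv.2]⟩
  obtain ⟨h2, hgx⟩ := h1 hε
  have hx2 : 2 * x / 2 = x := mul_div_cancel_left₀ x two_ne_zero
  simp only [hx2] at h2
  have haff := tendsto_affinity_of_lOneDist hp hs (e := x) (θ := θ)
    (hGc _ (by have : θ - x = 2 * θ - v := by rw [hx]; ring
               rw [this]; exact hvR))
    (hGc _ (by have : θ + x = v := by rw [hx]; ring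
               rw [this]; exact hvG))
  set I : ℝ → ℝ := fun w => (relRenyi μ s (p (w - x)) (p (w + x))).toReal with hI
  have hIeq : ∀ w ∈ Icc (θ - 1) (θ + 1),
      -Real.log (affinity μ s (p (w - x)) (p (w + x))).toReal = I w := by
    intro w hw
    rw [(h2 s hs w hw).1, ENNReal.toReal_ofReal (Real.exp_pos _).le, Real.log_exp, neg_neg]
  have hθ : θ ∈ Icc (θ - 1) (θ + 1) := ⟨by linarith, by linarith⟩
  have hnear : ∀ᶠ w in 𝓝 θ, w ∈ Icc (θ - 1) (θ + 1) :=
    Icc_mem_nhds (by linarith) (by linarith)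
  have hIc : Tendsto I (𝓝 θ) (𝓝 (I θ)) := by
    have hfin : affinity μ s (p (θ - x)) (p (θ + x)) ≠ ⊤ := by
      rw [(h2 s hs θ hθ).1]; exact ENNReal.ofReal_ne_top
    have h3 := (ENNReal.tendsto_toReal hfin).comp haff
    have h4 := (h3.log (by
      rw [(h2 s hs θ hθ).1, ENNReal.toReal_ofReal (Real.exp_pos _).le]
      exact (Real.exp_pos _).ne')).neg
    rw [hIeq θ hθ] at h4
    refine h4.congr' ?_
    filter_upwards [hnear] with w hw using hIeq w hw
  have hIg : ∀ᶠ w in 𝓝 θ, |I w / g (2 * x) - I θ / g (2 * x)| < δ / 3 := by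
    have := (hIc.div_const (g (2 * x))).eventually (Metric.ball_mem_nhds _
      (show 0 < δ / 3 by linarith))
    exact this
  filter_upwards [hnear, hIg] with w hw hw'
  have a1 := abs_lt.1 hw'
  have a2 := abs_lt.1 (h2 s hs w hw).2.2
  have a3 := abs_lt.1 (h2 s hs θ hθ).2.2
  rw [Real.dist_eq, abs_lt]
  constructor <;> linarith [a1.1, a1.2, a2.1, a2.2, a3.1, a3.2]

end Family

/-! ### Estimators, tests and split parameter intervals -/

section Estimators

variable {Ω : Type*} [MeasurableSpace Ω] {μ : Measure Ω} {p : ℝ → Ω → ℝ≥0} {g : ℝ → ℝ}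
  {J : ℝ → ℝ → ℝ}

theorem eventually_lt_firstRate {T : (n : ℕ) → (Fin n → Ω) → ℝ} {θ α : ℝ}
    (hgpos : ∀ᶠ ε : ℝ in 𝓝[>] 0, 0 < g ε) (hα : (α : EReal) < alphaTwoOf μ p g T θ) :
    ∀ᶠ ε : ℝ in 𝓝[>] 0, ∀ θ' ∈ Icc (θ - ε) (θ + ε),
      ((α * g ε : ℝ) : EReal) < firstRate μ p T θ' ε := by
  filter_upwards [hgpos, eventually_lt_of_lt_liminf hα] with ε h1 h2 θ' hθ'
  rw [EReal.lt_div_iff (by exact_mod_cast h1) (EReal.coe_ne_top _), ← EReal.coe_mul] at h2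
  exact h2.trans_le (iInf₂_le θ' hθ')

/-- Replaces the symmetric pair `θ ∓ ε/2` by the pair `θ - x ε`, `θ + (1 - x) ε`. -/
theorem eventually_renyi_split (hp : IsDensityFamily μ p) (hJ : RenyiLimitLocallyUniform μ p g J)
    (θ : ℝ) {x : ℝ} (hx : x ∈ Ioo (0 : ℝ) 1) {δ : ℝ} (hδ : 0 < δ) :
    ∀ᶠ ε : ℝ in 𝓝[>] 0, ∀ s ∈ Ioo (0 : ℝ) 1,
      affinity μ s (p (θ - x * ε)) (p (θ + (1 - x) * ε)) = ENNReal.ofReal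
        (Real.exp (-(relRenyi μ s (p (θ - x * ε)) (p (θ + (1 - x) * ε))).toReal)) ∧
      0 ≤ (relRenyi μ s (p (θ - x * ε)) (p (θ + (1 - x) * ε))).toReal ∧
      |(relRenyi μ s (p (θ - x * ε)) (p (θ + (1 - x) * ε))).toReal / g ε -
        J s (θ + (1 / 2 - x) * ε)| < δ := by
  filter_upwards [eventually_renyi hp hJ (K := Icc (θ - 1) (θ + 1)) isCompact_Icc hδ,
    Ioo_mem_nhdsGT one_pos] with ε h hε s hs
  have := h s hs (θ + (1 / 2 - x) * ε)
    ⟨by nlinarith [hx.1, hx.2, hε.1, hε.2], by nlinarith [hx.1, hx.2, hε.1, hε.2]⟩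
  rwa [show θ + (1 / 2 - x) * ε - ε / 2 = θ - x * ε by ring,
    show θ + (1 / 2 - x) * ε + ε / 2 = θ + (1 - x) * ε by ring] at this

theorem tendsto_renyi_split (hp : IsDensityFamily μ p) (hJ : RenyiLimitLocallyUniform μ p g J)
    {s θ : ℝ} (hs : s ∈ Ioo (0 : ℝ) 1) (hc : ContinuousAt (J s) θ) {x : ℝ}
    (hx : x ∈ Ioo (0 : ℝ) 1) :
    Tendsto (fun ε => (relRenyi μ s (p (θ - x * ε)) (p (θ + (1 - x) * ε))).toReal / g ε)
      (𝓝[>] 0) (𝓝 (J s θ)) := by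
  have hmid : Tendsto (fun ε : ℝ => θ + (1 / 2 - x) * ε) (𝓝[>] 0) (𝓝 θ) := by
    have : Continuous fun ε : ℝ => θ + (1 / 2 - x) * ε := by fun_prop
    simpa using (this.tendsto 0).mono_left nhdsWithin_le_nhds
  have h1 := hc.tendsto.comp hmid
  have h2 : Tendsto (fun ε => (relRenyi μ s (p (θ - x * ε)) (p (θ + (1 - x) * ε))).toReal / g ε -
      J s (θ + (1 / 2 - x) * ε)) (𝓝[>] 0) (𝓝 0) := by
    rw [Metric.tendsto_nhds]
    intro δ hδ
    filter_upwards [eventually_renyi_split hp hJ θ hx hδ] with ε h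
    rw [Real.dist_eq, sub_zero]
    exact (h s hs).2.2
  simpa [Function.comp_def] using h2.add h1

theorem eventually_concaveOn_renyi_split (hp : IsDensityFamily μ p)
    (hJ : RenyiLimitLocallyUniform μ p g J) (hgpos : ∀ᶠ ε : ℝ in 𝓝[>] 0, 0 < g ε) (θ : ℝ) {x : ℝ}
    (hx : x ∈ Ioo (0 : ℝ) 1) :
    ∀ᶠ ε : ℝ in 𝓝[>] 0, ConcaveOn ℝ (Ioo (0 : ℝ) 1) fun s =>
      (relRenyi μ s (p (θ - x * ε)) (p (θ + (1 - x) * ε))).toReal / g ε := by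
  filter_upwards [eventually_renyi_split hp hJ θ hx one_pos, hgpos] with ε h hg
  have := (concaveOn_of_affinity_eq (hp.measurable _) (hp.measurable _)
    fun s hs => (h s hs).1).smul (inv_pos.2 hg).le
  simpa only [smul_eq_mul, inv_mul_eq_div] using this

theorem eventually_renyi_split_nonneg (hp : IsDensityFamily μ p)
    (hJ : RenyiLimitLocallyUniform μ p g J) (hgpos : ∀ᶠ ε : ℝ in 𝓝[>] 0, 0 < g ε) (θ : ℝ) {x : ℝ}
    (hx : x ∈ Ioo (0 : ℝ) 1) :
    ∀ᶠ ε : ℝ in 𝓝[>] 0, ∀ s ∈ Ioo (0 : ℝ) 1,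
      0 ≤ (relRenyi μ s (p (θ - x * ε)) (p (θ + (1 - x) * ε))).toReal / g ε := by
  filter_upwards [eventually_renyi_split hp hJ θ hx one_pos, hgpos] with ε h hg s hs
  exact div_nonneg (h s hs).2.1 hg.le

theorem limit_concaveOn_nonneg (hp : IsDensityFamily μ p)
    (hJ : RenyiLimitLocallyUniform μ p g J) (hgpos : ∀ᶠ ε : ℝ in 𝓝[>] 0, 0 < g ε) {θ : ℝ}
    (hc : ∀ s ∈ Ioo (0 : ℝ) 1, ContinuousAt (J s) θ) :
    ConcaveOn ℝ (Ioo (0 : ℝ) 1) (fun s => J s θ) ∧ ∀ s ∈ Ioo (0 : ℝ) 1, 0 ≤ J s θ := by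
  have hx : (1 / 2 : ℝ) ∈ Ioo (0 : ℝ) 1 := by norm_num
  have hlim := fun s hs => tendsto_renyi_split hp hJ (s := s) hs (hc s hs) hx
  refine ⟨⟨convex_Ioo 0 1, fun s hs t ht a b ha hb hab => ?_⟩, fun s hs => ?_⟩
  · have hm := convex_Ioo (0 : ℝ) 1 hs ht ha hb hab
    refine le_of_tendsto_of_tendsto (((hlim s hs).const_smul a).add ((hlim t ht).const_smul b))
      (hlim _ hm) ?_
    filter_upwards [eventually_concaveOn_renyi_split hp hJ hgpos θ hx] with ε h
    exact h.2 hs ht ha hb hab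
  · refine ge_of_tendsto (hlim s hs) ?_
    filter_upwards [eventually_renyi_split_nonneg hp hJ hgpos θ hx] with ε h using h s hs

theorem exists_line_lt_limit [SigmaFinite μ] (hp : IsDensityFamily μ p)
    (hJ : RenyiLimitLocallyUniform μ p g J) (hgpos : ∀ᶠ ε : ℝ in 𝓝[>] 0, 0 < g ε) {κ : ℝ}
    (hκ : ∀ x : ℝ, 0 < x → Tendsto (fun ε : ℝ => g (x * ε) / g ε) (𝓝[>] 0) (𝓝 (x ^ κ)))
    {θ : ℝ} (hc : ∀ s ∈ Ioo (0 : ℝ) 1, ContinuousAt (J s) θ) {T : (n : ℕ) → (Fin n → Ω) → ℝ}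
    (hT : ∀ n, Measurable (T n)) {α : ℝ} (hα : (α : EReal) < alphaTwoOf μ p g T θ) {x : ℝ}
    (hx : x ∈ Ioo (0 : ℝ) 1) {A B : ℝ} (hA : A < α * x ^ κ) (hB : B < α * (1 - x) ^ κ) :
    ∃ s ∈ Ioo (0 : ℝ) 1, s * A + (1 - s) * B < J s θ := by
  have hx0 := hx.1
  have hx1 : 0 < 1 - x := sub_pos.2 hx.2
  have hrate := eventually_lt_firstRate hgpos hα
  refine exists_line_lt_of_tangent_dichotomy ((hκ x hx0).const_mul α)
    ((hκ (1 - x) hx1).const_mul α) (eventually_concaveOn_renyi_split hp hJ hgpos θ hx) ?_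
    (eventually_renyi_split_nonneg hp hJ hgpos θ hx) ?_
    (fun s hs => tendsto_renyi_split hp hJ hs (hc s hs) hx) hA hB
  · filter_upwards [eventually_renyi_split hp hJ θ hx one_pos] with ε h s hs
    exact (differentiableAt_of_affinity_eq (hp.measurable _) (hp.measurable _)
      (fun s hs => (h s hs).1) s hs).div_const _
  · filter_upwards [eventually_renyi_split hp hJ θ hx one_pos, hgpos,
      (tendsto_const_mul_nhdsGT hx0).eventually hrate,
      (tendsto_const_mul_nhdsGT hx1).eventually hrate, self_mem_nhdsWithin]
      with ε h hg h1 h2 hε s hs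
    have hε0 : 0 < ε := hε
    have hxε : 0 < x * ε := mul_pos hx0 hε0
    have hxε1 : 0 < (1 - x) * ε := mul_pos hx1 hε0
    have hI : ∀ s ∈ Ioo (0 : ℝ) 1, _ := fun s hs => (h s hs).1
    have hd := (differentiableAt_of_affinity_eq (hp.measurable _) (hp.measurable _) hI s hs)
    -- The rate condition is used at radius `x ε` here and `(1-x) ε` below, with the parameter at
    -- the edge of the window. Deciding on the wrong side of `θ` forces an error at least that
    -- radius.
    have e1 := eventually_iidLaw_le_of_lt_firstRate (h1 (θ - x * ε) ⟨le_rfl, by linarith⟩)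
      (A := fun n => {y | θ ≤ T n y}) fun n y hy => by
        have hy' : θ ≤ T n y := hy
        exact le_trans (by linarith) (le_abs_self (T n y - (θ - x * ε)))
    have e2 := eventually_iidLaw_le_of_lt_firstRate
      (h2 (θ + (1 - x) * ε) ⟨by linarith, le_rfl⟩)
      (A := fun n => {y | θ ≤ T n y}ᶜ) fun n y hy => by
        have hy' : T n y < θ := not_le.1 hy
        exact le_trans (by linarith) (neg_le_abs (T n y - (θ + (1 - x) * ε)))
    have htan := tangent_dichotomy_of_chord hs hd.hasDerivAt
      fun a b t u ha hb ht hu hst hsu => chord_dichotomy_of_tests μ (hp.measurable _)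
        (hp.measurable _) hI (fun n => measurableSet_le measurable_const (hT n)) e1 e2 hs ha hb
        ht hu hst hsu
    rw [deriv_div_const]
    refine htan.imp (fun h3 => ?_) (fun h3 => ?_)
    · have := div_le_div_of_nonneg_right h3 hg.le
      rwa [add_div, mul_div_assoc, mul_div_assoc] at this
    · have := div_le_div_of_nonneg_right h3 hg.le
      rwa [sub_div, mul_div_assoc, mul_div_assoc] at this

theorem alphaTwoBar_nonneg {κ : ℝ} {j : ℝ → ℝ} (hj : ∀ s ∈ Ioo (0 : ℝ) 1, 0 ≤ j s) :
    0 ≤ alphaTwoBar κ j := by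
  have hterm : ∀ s ∈ Ioo (0 : ℝ) 1, (0 : EReal) ≤ ((j s / (s * (1 - s)) *
      (s ^ (1 / (κ - 1)) + (1 - s) ^ (1 / (κ - 1))) ^ (κ - 1) : ℝ) : EReal) := by
    intro s hs
    have h0 := hs.1
    have h1 : 0 < 1 - s := sub_pos.2 hs.2
    have := hj s hs
    exact EReal.coe_nonneg.2 (by positivity)
  unfold alphaTwoBar
  split_ifs with h1 h2
  · exact le_iSup₂_of_le (1 / 2) (by norm_num) (hterm (1 / 2) (by norm_num))
  · exact EReal.coe_nonneg.2 (mul_nonneg two_pos.le (hj _ (by norm_num)))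
  · exact le_iInf₂ hterm

end Estimators

/-! ### The upper bound -/

theorem theorem2 {Ω : Type*} [MeasurableSpace Ω] (μ : Measure Ω) [SigmaFinite μ]
    (p : ℝ → Ω → ℝ≥0) (hp : IsDensityFamily μ p)
    (g : ℝ → ℝ) (hg0 : g 0 = 0)
    (hg : ∃ r : ℝ, 0 < r ∧ StrictMonoOn g (Icc 0 r) ∧ ContinuousOn g (Icc 0 r))
    (κ : ℝ) (hκ0 : 0 < κ)
    (hκ : ∀ x : ℝ, 0 < x → Tendsto (fun ε : ℝ => g (x * ε) / g ε) (𝓝[>] 0) (𝓝 (x ^ κ)))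
    (J : ℝ → ℝ → ℝ) (hJ : RenyiLimitLocallyUniform μ p g J) (θ : ℝ) :
    alphaTwo μ p g θ ≤ alphaTwoBar κ (fun s => J s θ) := by
  obtain ⟨r, hr, hgm, hgc⟩ := hg
  have hgpos := eventually_gauge_pos hr hg0 hgm
  have hc : ∀ s ∈ Ioo (0 : ℝ) 1, ContinuousAt (J s) θ := fun s hs =>
    continuousAt_limit hp hJ hg0 hr hgm hgc hs θ
  obtain ⟨hconc, hnonneg⟩ := limit_concaveOn_nonneg hp hJ hgpos hc
  refine iSup₂_le fun T hT => ?_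
  by_contra! hlt
  obtain ⟨α, hα1, hα2⟩ := EReal.lt_iff_exists_real_btwn.1 hlt
  have hα : 0 < α := by exact_mod_cast (alphaTwoBar_nonneg hnonneg).trans_lt hα1
  have hlines : ∀ A B : ℝ, 0 ≤ A → 0 ≤ B →
      (∀ s ∈ Ioo (0 : ℝ) 1, J s θ ≤ s * A + (1 - s) * B) →
      α ^ (1 / κ) ≤ A ^ (1 / κ) + B ^ (1 / κ) := fun A B hA hB hAB =>
    rpow_inv_le_of_lines hα hκ0 (fun x hx A B => exists_line_lt_limit hp hJ hgpos hκ hc hT hα2 hx)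
      hA hB hAB
  unfold alphaTwoBar at hα1
  split_ifs at hα1 with h1 h2
  -- The supremum is an extended real, so a real `M` between it and `α` serves as the uniform bound.
  · obtain ⟨M, hM1, hM2⟩ := EReal.lt_iff_exists_real_btwn.1 hα1
    have hle : α ≤ M := le_of_lines_of_lt_one hα hκ0 h1 hconc hnonneg hlines fun s hs => by
      exact_mod_cast (le_iSup₂ (f := fun (s : ℝ) (_ : s ∈ Ioo (0 : ℝ) 1) =>
        ((J s θ / (s * (1 - s)) *
          (s ^ (1 / (κ - 1)) + (1 - s) ^ (1 / (κ - 1))) ^ (κ - 1) : ℝ) : EReal)) s hs).trans hM1.le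
    exact absurd (EReal.coe_lt_coe_iff.1 hM2) (not_lt.2 hle)
  · have := le_two_mul_of_lines hconc hnonneg (α := α) fun A B hA hB hAB => by
      simpa [h2] using hlines A B hA hB hAB
    exact absurd (EReal.coe_lt_coe_iff.1 hα1) (not_lt.2 this)
  · have hκ1 : 1 < κ := lt_of_le_of_ne (not_lt.1 h1) (Ne.symm h2)
    simp only [iInf_lt_iff] at hα1
    obtain ⟨s, hs, hlt⟩ := hα1
    exact absurd (EReal.coe_lt_coe_iff.1 hlt)
      (not_lt.2 (le_of_lines_of_one_lt hα hκ1 hconc hnonneg hlines hs))
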